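/- **Setting.** Let $\kappa>0$, $m>0$ and $a,Q,P\in\mathbb R$ with $E_-:=1-\kappa^2a^2>0$, and put $$U=r^2+a^2\cos^2\theta,\qquad \Delta_-(r)=(r^2+a^2)(1+\kappa^2r^2)-2mr+Q^2+P^2,\qquad \Delta_-(\theta)=1-\kappa^2a^2\cos^2\theta .$$ The Kerr-Newman-AdS spacetime has, in Boyer-Lindquist coordinates $(t,r,\theta,\varphi)$, the metric $g=-e^0\otimes e^0+e^1\otimes e^1+e^2\otimes e^2+e^3\otimes e^3$ with orthonormal coframe $$e^0=\sqrt{\tfrac{\Delta_-(r)}{U}}\Big(dt-\tfrac{a\sin^2\theta}{E_-}d\varphi\Big),\quad e^1=\sqrt{\tfrac{U}{\Delta_-(r)}}\,dr,\quad e^2=\sqrt{\tfrac{U}{\Delta_-(\theta)}}\,d\theta,\quad e^3=\sqrt{\tfrac{\Delta_-(\theta)}{U}}\sin\theta\Big(a\,dt-\tfrac{r^2+a^2}{E_-}d\varphi\Big),$$ dual frame $(e_\alpha)$, and electromagnetic potential $$A=-\frac{Qr}{U}\Big(dt-\frac{a\sin^2\theta}{E_-}d\varphi\Big)-\frac{P\cos\theta}{U}\Big(a\,dt-\frac{r^2+a^2}{E_-}d\varphi\Big).$$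 It is called extreme, with horizon radius $r_e$, if the quartic $\Delta_-(r)$ has a double root $r_e>0$ and its two other roots are not real. Spinors are $\mathbb C^4$-valued functions in this frame. Clifford multiplication is by the matrices $$e^0=\begin{pmatrix}0&-I_2\\-I_2&0\end{pmatrix},\qquad e^j=\begin{pmatrix}0&s_j\\-s_j&0\end{pmatrix}\ (j=1,2,3),\qquad s_1=\begin{pmatrix}-1&0\\0&1\end{pmatrix},\quad s_2=\begin{pmatrix}0&1\\1&0\end{pmatrix},\quad s_3=\begin{pmatrix}0&i\\-i&0\end{pmatrix},$$ so that $e^\alpha e^\beta+e^\beta e^\alpha=-2g(e^\alpha,e^\beta)$. The Dirac operator is $\mathscr D\Psi=\sum_\alpha e^\alpha\cdot\nabla_{e_\alpha}\Psi$ with $$\nabla_X\Psi=X(\Psi)-\tfrac12\sum_{\alpha<\beta}\omega_{\alpha\beta}(X)\,e^\alpha\cdot e^\beta\cdot\Psi,$$ where $\omega_{\alpha\beta}=-\omega_{\beta\alpha}$ are the Levi-Civita connection forms: $de^\alpha=-\sum_\beta\omega^\alpha{}_\beta\wedge e^\beta$, the index $\alpha$ being lowered with the signature $(-,+,+,+)$.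 **Theorem.** Let the Kerr-Newman-AdS spacetime be extreme with horizon radius $r_e$, let $\lambda,\omega\in\mathbb R$, $k\in\mathbb Z$, and let $X_\pm$, $Y_\pm$ be complex-valued functions such that $$\Psi=S_-^{-1}\Phi,\qquad \Phi=e^{-i(\omega t+(k+\frac12)\varphi)}\begin{pmatrix}X_-(r)Y_-(\theta)\\X_+(r)Y_+(\theta)\\X_+(r)Y_-(\theta)\\X_-(r)Y_+(\theta)\end{pmatrix},$$ $$S_-=\Delta_-(r)^{1/4}\,\mathrm{diag}\big((r+ia\cos\theta)^{1/2},(r+ia\cos\theta)^{1/2},(r-ia\cos\theta)^{1/2},(r-ia\cos\theta)^{1/2}\big)$$ (principal square roots) is a differentiable, not identically vanishing solution of the Dirac equation $$\Big(\mathscr D+i\sum_\alpha A(e_\alpha)e^\alpha+i\lambda\Big)\Psi=0$$ on the exterior region $\{r>r_e,\ 0<\theta<\pi\}$. Suppose that for some $p\in[1,\infty)$ and some $t_0\in\mathbb R$ one has $\Psi\in L^p(M_{(r_e,+\infty)})$, where $M_{(r_e,+\infty)}$ is the slice $\{t=t_0,\ r>r_e\}$ with the volume measure of the metric induced by $g$,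 and $|\Psi|^2=\sum_{i=1}^4|\Psi_i|^2$. Then $$\omega\,(r_e^2+a^2)+\big(k+\tfrac12\big)E_-\,a+r_e\,Q=0 .$$ -/

import Mathlib

open Real MeasureTheory
open scoped Matrix ENNReal

noncomputable section

/-- The parameters of a Kerr-Newman-AdS spacetime: `κ > 0` (the cosmological constant is `-3κ²`),
the mass `m > 0`, the rotation parameter `a`, the electric charge `Q` and the magnetic charge `P`,
with `1 - κ²a² > 0`. -/
structure KerrNewmanAdS where
  κ : ℝ
  m : ℝ
  a : ℝ
  Q : ℝ
  P : ℝ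
  κ_pos : 0 < κ
  m_pos : 0 < m
  E_pos : 0 < 1 - κ ^ 2 * a ^ 2

namespace KerrNewmanAdS

/-- Boyer-Lindquist coordinates: `x 0 = t`, `x 1 = r`, `x 2 = θ`, `x 3 = φ`. -/
abbrev Coord : Type := Fin 4 → ℝ

/-- A spinor field, written in the spin frame belonging to the orthonormal frame below. -/
abbrev SpinorField : Type := Coord → Fin 4 → ℂ

/-! ### The metric functions -/

/-- `E₋ = 1 - κ²a²`. -/
def E (M : KerrNewmanAdS) : ℝ := 1 - M.κ ^ 2 * M.a ^ 2

/-- `U = r² + a² cos² θ`. -/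
def U (M : KerrNewmanAdS) (r θ : ℝ) : ℝ := r ^ 2 + M.a ^ 2 * cos θ ^ 2

/-- `Δ₋(r) = (r² + a²)(1 + κ²r²) - 2mr + Q² + P²`. -/
def deltaR (M : KerrNewmanAdS) (r : ℝ) : ℝ :=
  (r ^ 2 + M.a ^ 2) * (1 + M.κ ^ 2 * r ^ 2) - 2 * M.m * r + M.Q ^ 2 + M.P ^ 2

/-- `Δ₋(θ) = 1 - κ²a² cos² θ`. -/
def deltaTheta (M : KerrNewmanAdS) (θ : ℝ) : ℝ := 1 - M.κ ^ 2 * M.a ^ 2 * cos θ ^ 2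

/-- `Δ₋(r)` as a polynomial in `r`. -/
def deltaPoly (M : KerrNewmanAdS) : Polynomial ℝ :=
  (Polynomial.X ^ 2 + Polynomial.C (M.a ^ 2)) *
      (1 + Polynomial.C (M.κ ^ 2) * Polynomial.X ^ 2)
    - Polynomial.C (2 * M.m) * Polynomial.X + Polynomial.C (M.Q ^ 2 + M.P ^ 2)

theorem eval_deltaPoly (M : KerrNewmanAdS) (r : ℝ) : M.deltaPoly.eval r = M.deltaR r := by
  simp [deltaPoly, deltaR]
  ring

/-- The spacetime is extreme with horizon radius `re`: the quartic `Δ₋` has a positive double root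
`re`, and its two remaining roots are not real. -/
def IsExtreme (M : KerrNewmanAdS) (re : ℝ) : Prop :=
  0 < re ∧ M.deltaPoly.rootMultiplicity re = 2 ∧ ∀ r : ℝ, M.deltaPoly.IsRoot r → r = re

/-- The exterior region `r > re`, in the Boyer-Lindquist chart (the axis `θ ∈ {0, π}` is not
covered by the chart). -/
def exterior (re : ℝ) : Set Coord := {x | re < x 1 ∧ 0 < x 2 ∧ x 2 < π}

/-! ### Orthonormal coframe and frame, metric -/

/-- The signature `(-,+,+,+)`. -/
def sign : Fin 4 → ℝ := ![-1, 1, 1, 1]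

/-- The orthonormal coframe: `M.coframe α x μ` is the coefficient of `dx^μ` in
`e⁰ = √(Δ₋(r)/U) (dt - (a sin²θ/E₋) dφ)`, `e¹ = √(U/Δ₋(r)) dr`, `e² = √(U/Δ₋(θ)) dθ`,
`e³ = √(Δ₋(θ)/U) sin θ (a dt - ((r²+a²)/E₋) dφ)`. -/
def coframe (M : KerrNewmanAdS) (α : Fin 4) (x : Coord) : Fin 4 → ℝ :=
  ![![√(M.deltaR (x 1) / M.U (x 1) (x 2)), 0, 0,
      √(M.deltaR (x 1) / M.U (x 1) (x 2)) * -(M.a * sin (x 2) ^ 2 / M.E)],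
    ![0, √(M.U (x 1) (x 2) / M.deltaR (x 1)), 0, 0],
    ![0, 0, √(M.U (x 1) (x 2) / M.deltaTheta (x 2)), 0],
    ![√(M.deltaTheta (x 2) / M.U (x 1) (x 2)) * sin (x 2) * M.a, 0, 0,
      √(M.deltaTheta (x 2) / M.U (x 1) (x 2)) * sin (x 2)
        * -(((x 1) ^ 2 + M.a ^ 2) / M.E)]] α

/-- The dual orthonormal frame: `M.frame α x μ` is the coefficient of `∂_μ` in
`e₀ = ((r²+a²)/√(U Δ₋(r))) (∂_t + (a E₋/(r²+a²)) ∂_φ)`, `e₁ = √(Δ₋(r)/U) ∂_r`,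
`e₂ = √(Δ₋(θ)/U) ∂_θ`, `e₃ = -(1/√(U Δ₋(θ))) (a sin θ ∂_t + (E₋/sin θ) ∂_φ)`. -/
def frame (M : KerrNewmanAdS) (α : Fin 4) (x : Coord) : Fin 4 → ℝ :=
  ![![((x 1) ^ 2 + M.a ^ 2) / √(M.U (x 1) (x 2) * M.deltaR (x 1)), 0, 0,
      ((x 1) ^ 2 + M.a ^ 2) / √(M.U (x 1) (x 2) * M.deltaR (x 1))
        * (M.a * M.E / ((x 1) ^ 2 + M.a ^ 2))],
    ![0, √(M.deltaR (x 1) / M.U (x 1) (x 2)), 0, 0],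
    ![0, 0, √(M.deltaTheta (x 2) / M.U (x 1) (x 2)), 0],
    ![-1 / √(M.U (x 1) (x 2) * M.deltaTheta (x 2)) * (M.a * sin (x 2)), 0, 0,
      -1 / √(M.U (x 1) (x 2) * M.deltaTheta (x 2)) * (M.E / sin (x 2))]] α

/-- The components `g_{μν}` of the Lorentzian metric
`g = -e⁰ ⊗ e⁰ + e¹ ⊗ e¹ + e² ⊗ e² + e³ ⊗ e³`. -/
def metric (M : KerrNewmanAdS) (x : Coord) (μ ν : Fin 4) : ℝ :=
  ∑ α, sign α * M.coframe α x μ * M.coframe α x ν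

/-! ### The spin connection and the Dirac operator -/

/-- The partial derivative with respect to the coordinate `x^μ`. -/
def partialDeriv {F : Type*} [NormedAddCommGroup F] [NormedSpace ℝ F]
    (μ : Fin 4) (f : Coord → F) (x : Coord) : F :=
  deriv (fun s : ℝ => f (Function.update x μ s)) (x μ)

/-- `M.dCoframe γ α β x = de_γ (e_α, e_β)`, the exterior derivative of the coframe form with its
index lowered by the signature, evaluated on the frame. -/
def dCoframe (M : KerrNewmanAdS) (γ α β : Fin 4) (x : Coord) : ℝ :=
  sign γ * ∑ μ, ∑ ν,
    (partialDeriv μ (fun y => M.coframe γ y ν) x - partialDeriv ν (fun y => M.coframe γ y μ) x)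
      * M.frame α x μ * M.frame β x ν

/-- `M.connection α β γ x = ω_{αβ}(e_γ)`, where `ω_{αβ} = -ω_{βα}` are the Levi-Civita connection
1-forms, that is, the unique skew solution of Cartan's structure equations
`de_α = -∑ β, ω_{αβ} ∧ e^β`; equivalently `∇e^α = -∑ β, ω^α_β ⊗ e^β`. -/
def connection (M : KerrNewmanAdS) (α β γ : Fin 4) (x : Coord) : ℝ :=
  (M.dCoframe α β γ x + M.dCoframe β γ α x - M.dCoframe γ α β x) / 2

/-- Clifford multiplication by `e^α`, normalized by `e^α e^β + e^β e^α = -2 g(e^α, e^β)`. -/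
def gamma (α : Fin 4) : Matrix (Fin 4) (Fin 4) ℂ :=
  ![!![0, 0, -1, 0; 0, 0, 0, -1; -1, 0, 0, 0; 0, -1, 0, 0],
    !![0, 0, -1, 0; 0, 0, 0, 1; 1, 0, 0, 0; 0, -1, 0, 0],
    !![0, 0, 0, 1; 0, 0, 1, 0; 0, -1, 0, 0; -1, 0, 0, 0],
    !![0, 0, 0, Complex.I; 0, 0, -Complex.I, 0; 0, -Complex.I, 0, 0; Complex.I, 0, 0, 0]] α

/-- The spinorial Levi-Civita derivative
`∇_{e_γ} Ψ = e_γ(Ψ) - ½ ∑_{α<β} ω_{αβ}(e_γ) e^α · e^β · Ψ`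
(written as `-¼` times the sum over all `α, β`, both factors being skew). -/
def spinDeriv (M : KerrNewmanAdS) (γ : Fin 4) (Ψ : SpinorField) (x : Coord) : Fin 4 → ℂ :=
  ∑ μ, (M.frame γ x μ : ℂ) • partialDeriv μ Ψ x
    - (1 / 4 : ℂ) • ∑ α, ∑ β, (M.connection α β γ x : ℂ) • ((gamma α * gamma β) *ᵥ Ψ x)

/-- The Dirac operator `𝒟 Ψ = ∑ γ, e^γ · ∇_{e_γ} Ψ`. -/
def dirac (M : KerrNewmanAdS) (Ψ : SpinorField) (x : Coord) : Fin 4 → ℂ :=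
  ∑ γ, gamma γ *ᵥ M.spinDeriv γ Ψ x

/-- The components `A_μ` of the electromagnetic potential
`A = -(Qr/U)(dt - (a sin²θ/E₋) dφ) - (P cos θ/U)(a dt - ((r²+a²)/E₋) dφ)`. -/
def potential (M : KerrNewmanAdS) (x : Coord) : Fin 4 → ℝ :=
  ![-(M.Q * x 1 / M.U (x 1) (x 2)) - M.P * cos (x 2) / M.U (x 1) (x 2) * M.a, 0, 0,
    -(M.Q * x 1 / M.U (x 1) (x 2)) * -(M.a * sin (x 2) ^ 2 / M.E)
      - M.P * cos (x 2) / M.U (x 1) (x 2) * -(((x 1) ^ 2 + M.a ^ 2) / M.E)]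

/-- `A(e_α)`. -/
def potentialFrame (M : KerrNewmanAdS) (α : Fin 4) (x : Coord) : ℝ :=
  ∑ μ, M.potential x μ * M.frame α x μ

/-- `Ψ` is a (classical) solution of the Dirac equation
`(𝒟 + i e^α A(e_α) + iλ) Ψ = 0` on the exterior region `r > re`. -/
def IsDiracSolution (M : KerrNewmanAdS) (re lam : ℝ) (Ψ : SpinorField) : Prop :=
  DifferentiableOn ℝ Ψ (exterior re) ∧
  ∀ x ∈ exterior re,
    M.dirac Ψ x
      + Complex.I • ∑ α, (M.potentialFrame α x : ℂ) • (gamma α *ᵥ Ψ x)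
      + (Complex.I * (lam : ℂ)) • Ψ x = 0

/-! ### Separated time-periodic spinors -/

/-- The diagonal matrix `S₋ = Δ₋(r)^{1/4} diag(ρ^{1/2}, ρ^{1/2}, ρ̄^{1/2}, ρ̄^{1/2})` with
`ρ = r + i a cos θ` and principal square roots. -/
def scaling (M : KerrNewmanAdS) (x : Coord) : Matrix (Fin 4) (Fin 4) ℂ :=
  ((M.deltaR (x 1) ^ (1 / 4 : ℝ) : ℝ) : ℂ) • Matrix.diagonal
    ![((x 1 : ℂ) + Complex.I * M.a * cos (x 2)) ^ (1 / 2 : ℂ),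
      ((x 1 : ℂ) + Complex.I * M.a * cos (x 2)) ^ (1 / 2 : ℂ),
      ((x 1 : ℂ) - Complex.I * M.a * cos (x 2)) ^ (1 / 2 : ℂ),
      ((x 1 : ℂ) - Complex.I * M.a * cos (x 2)) ^ (1 / 2 : ℂ)]

/-- The separated spinor
`Φ = exp(-i(ωt + (k + ½)φ)) (X₋(r)Y₋(θ), X₊(r)Y₊(θ), X₊(r)Y₋(θ), X₋(r)Y₊(θ))ᵀ`. -/
def separated (ω : ℝ) (k : ℤ) (Xp Xm Yp Ym : ℝ → ℂ) (x : Coord) : Fin 4 → ℂ :=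
  Complex.exp (-Complex.I * (ω * x 0 + ((k : ℂ) + 1 / 2) * x 3)) •
    ![Xm (x 1) * Ym (x 2), Xp (x 1) * Yp (x 2), Xp (x 1) * Ym (x 2), Xm (x 1) * Yp (x 2)]

/-! ### The time slice -/

/-- The Riemannian volume measure, in the coordinates `(r, θ, φ)`, of the slice
`{t = t₀, r > re}` with the metric induced by `g`. -/
def sliceVolume (M : KerrNewmanAdS) (re t₀ : ℝ) : Measure (ℝ × ℝ × ℝ) :=
  (volume.restrict (Set.Ioi re ×ˢ Set.Ioo 0 π ×ˢ Set.Ioo 0 (2 * π))).withDensity fun q =>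
    ENNReal.ofReal √(Matrix.det (Matrix.of fun i j : Fin 3 =>
      M.metric ![t₀, q.1, q.2.1, q.2.2] i.succ j.succ))

/-- `Ψ ∈ L^p` on the slice `{t = t₀, r > re}`, with `|Ψ|² = ∑ |Ψ_i|²`. -/
def MemLpSlice (M : KerrNewmanAdS) (re t₀ p : ℝ) (Ψ : SpinorField) : Prop :=
  MemLp (fun q : ℝ × ℝ × ℝ =>
      (WithLp.toLp 2 (Ψ ![t₀, q.1, q.2.1, q.2.2]) : EuclideanSpace ℂ (Fin 4)))
    (ENNReal.ofReal p) (M.sliceVolume re t₀)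

end KerrNewmanAdS

end

/-! ### The orthonormal coframe and its first derivatives -/

namespace KerrNewmanAdS

/-! Write `W(r) = ω(r² + a²) + (k + ½)E₋a + rQ` and suppose `W(re) ≠ 0`; the claim is that `Ψ` is
then in no `L^p`. Two facts collide: a nontrivial radial solution cannot decay at the horizon, and
the horizon of an extreme slice lies at the end of a throat of infinite volume.

Computing the spin connection and absorbing its logarithmic derivatives into `S₋` turns the Dirac
equation into four scalar equations (`separated_system`). No separation constant is needed: at a
single angle where `Y₋` or `Y₊` is nonzero, dividing two of these equations by that value gives `A
X₊' - (iW/A) X₊ = q₁ X₋` and `A X₋' + (iW/A) X₋ = q₂ X₊`, with `A = √Δ₋` vanishing to first order at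
`re` and `q₁`, `q₂` affine in `r`.

For `N = |X₊|² + |X₋|²` one has `N' = Re (2 q Z / A)` with `q = q₁ + conj q₂` and `Z = X₋ conj X₊`.
A direct estimate only gives `|N'| ≤ C N / (r - re)`, which would allow power decay. But `Z` carries
a phase rotating at rate `-2W/A²`, so the singular term is, up to bounded multiples of `N`, the
derivative of `Re (i A q Z / W)`. This is one integration by parts in an oscillatory integral, and
`W(re) ≠ 0` is what permits the division. Subtracting this small correction from `N` gives a
quantity obeying a regular Gronwall inequality, so `N` stays above a positive constant
(`exists_pos_le_energy`).

Since `√Δ₋ √U |Ψ|²` dominates `N` times the square of an angular factor, `|Ψ|` is bounded below on a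
box touching the horizon. The volume density there is of order `1 / (r - re)`, so the box has
infinite volume (`sliceVolume_eq_top`), contradicting integrability of `|Ψ|^p`. -/

theorem U_nonneg (M : KerrNewmanAdS) (r θ : ℝ) : 0 ≤ M.U r θ := by
  unfold U; positivity

theorem U_pos (M : KerrNewmanAdS) {r : ℝ} (hr : 0 < r) (θ : ℝ) : 0 < M.U r θ := by
  unfold U; positivity

theorem deltaTheta_pos (M : KerrNewmanAdS) (θ : ℝ) : 0 < M.deltaTheta θ := by
  have h1 := M.E_pos
  have h2 := Real.cos_sq_le_one θ
  have h3 : M.κ ^ 2 * M.a ^ 2 * cos θ ^ 2 ≤ M.κ ^ 2 * M.a ^ 2 * 1 := by gcongr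
  unfold deltaTheta
  linarith

/-- Splitting the roots of quotients makes `√Δ₋(r)`, `√U` and `√Δ₋(θ)` the only irrational atoms, so
that later identities are rational in them. -/
theorem coframe_eq (M : KerrNewmanAdS) (α : Fin 4) (x : Coord) :
    M.coframe α x =
  ![![√(M.deltaR (x 1)) / √(M.U (x 1) (x 2)), 0, 0,
      √(M.deltaR (x 1)) / √(M.U (x 1) (x 2)) * -(M.a * sin (x 2) ^ 2 / M.E)],
    ![0, √(M.U (x 1) (x 2)) / √(M.deltaR (x 1)), 0, 0],
    ![0, 0, √(M.U (x 1) (x 2)) / √(M.deltaTheta (x 2)), 0],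
    ![√(M.deltaTheta (x 2)) / √(M.U (x 1) (x 2)) * sin (x 2) * M.a, 0, 0,
      √(M.deltaTheta (x 2)) / √(M.U (x 1) (x 2)) * sin (x 2)
        * -(((x 1) ^ 2 + M.a ^ 2) / M.E)]] α := by
  unfold coframe
  rw [Real.sqrt_div' _ (M.U_nonneg _ _), Real.sqrt_div (M.U_nonneg _ _),
    Real.sqrt_div (M.U_nonneg _ _), Real.sqrt_div' _ (M.U_nonneg _ _)]

theorem frame_eq (M : KerrNewmanAdS) (α : Fin 4) {x : Coord} (hx : 0 < x 1) :
    M.frame α x =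
  ![![((x 1) ^ 2 + M.a ^ 2) / (√(M.U (x 1) (x 2)) * √(M.deltaR (x 1))), 0, 0,
      M.a * M.E / (√(M.U (x 1) (x 2)) * √(M.deltaR (x 1)))],
    ![0, √(M.deltaR (x 1)) / √(M.U (x 1) (x 2)), 0, 0],
    ![0, 0, √(M.deltaTheta (x 2)) / √(M.U (x 1) (x 2)), 0],
    ![-(M.a * sin (x 2)) / (√(M.U (x 1) (x 2)) * √(M.deltaTheta (x 2))), 0, 0,
      -M.E / (√(M.U (x 1) (x 2)) * √(M.deltaTheta (x 2)) * sin (x 2))]] α := by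
  unfold frame
  have h : x 1 ^ 2 + M.a ^ 2 ≠ 0 := by positivity
  rw [Real.sqrt_div' _ (M.U_nonneg _ _), Real.sqrt_div' _ (M.U_nonneg _ _),
    Real.sqrt_mul (M.U_nonneg _ _), Real.sqrt_mul (M.U_nonneg _ _)]
  congr 4
  · rw [div_mul_div_comm, mul_comm, mul_div_mul_right _ _ h]
  · congr 1
    · ring
    · congr 3
      rw [div_mul_div_comm, neg_one_mul]

theorem hasDerivAt_deltaR (M : KerrNewmanAdS) (r : ℝ) : HasDerivAt M.deltaR
    (2 * r * (1 + M.κ ^ 2 * r ^ 2) + (r ^ 2 + M.a ^ 2) * (M.κ ^ 2 * (2 * r)) - 2 * M.m) r := by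
  have h := ((((hasDerivAt_pow 2 r).add_const (M.a ^ 2)).mul
    (((hasDerivAt_pow 2 r).const_mul (M.κ ^ 2)).const_add 1)).sub
    ((hasDerivAt_id r).const_mul (2 * M.m))).add_const (M.Q ^ 2)|>.add_const (M.P ^ 2)
  convert! h using 1
  simp

theorem differentiable_deltaTheta (M : KerrNewmanAdS) : Differentiable ℝ M.deltaTheta := by
  unfold deltaTheta; fun_prop

/-- The radial derivative of `√Δ₋(r)`. -/
noncomputable def dSqrtR (M : KerrNewmanAdS) (r : ℝ) : ℝ := deriv (fun s => √(M.deltaR s)) r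

/-- The derivative of `√Δ₋(θ)`. -/
noncomputable def dSqrtTheta (M : KerrNewmanAdS) (θ : ℝ) : ℝ :=
  deriv (fun s => √(M.deltaTheta s)) θ

theorem hasDerivAt_sqrt_deltaR (M : KerrNewmanAdS) {r : ℝ} (h : 0 < M.deltaR r) :
    HasDerivAt (fun s => √(M.deltaR s)) (M.dSqrtR r) r :=
  ((M.hasDerivAt_deltaR r).sqrt h.ne').differentiableAt.hasDerivAt

theorem hasDerivAt_sqrt_deltaTheta (M : KerrNewmanAdS) (θ : ℝ) :
    HasDerivAt (fun s => √(M.deltaTheta s)) (M.dSqrtTheta θ) θ :=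
  ((M.differentiable_deltaTheta θ).sqrt (M.deltaTheta_pos θ).ne').hasDerivAt

theorem hasDerivAt_sqrt_U_left (M : KerrNewmanAdS) {r : ℝ} (hr : 0 < r) (θ : ℝ) :
    HasDerivAt (fun s => √(M.U s θ)) (r / √(M.U r θ)) r := by
  have h : HasDerivAt (fun s => M.U s θ) (2 * r) r := by
    simpa [U] using (hasDerivAt_pow 2 r).add_const (M.a ^ 2 * cos θ ^ 2)
  convert! h.sqrt (M.U_pos hr θ).ne' using 1
  ring

theorem hasDerivAt_sqrt_U_right (M : KerrNewmanAdS) {r : ℝ} (hr : 0 < r) (θ : ℝ) :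
    HasDerivAt (fun s => √(M.U r s)) (-(M.a ^ 2 * cos θ * sin θ) / √(M.U r θ)) θ := by
  have h : HasDerivAt (fun s => M.U r s) (-(2 * (M.a ^ 2 * cos θ * sin θ))) θ := by
    have := (((Real.hasDerivAt_cos θ).pow 2).const_mul (M.a ^ 2)).const_add (r ^ 2)
    convert! this using 1
    simp; ring
  convert! h.sqrt (M.U_pos hr θ).ne' using 1
  ring

section Derivatives

variable (M : KerrNewmanAdS) {x : Coord}

theorem partialDeriv_coframe_zero (γ ν : Fin 4) :
    partialDeriv 0 (fun y => M.coframe γ y ν) x = 0 := by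
  simp [partialDeriv, coframe]

theorem partialDeriv_coframe_three (γ ν : Fin 4) :
    partialDeriv 3 (fun y => M.coframe γ y ν) x = 0 := by
  simp [partialDeriv, coframe]

theorem partialDeriv_coframe_one (hx : 0 < x 1) (hΔ : 0 < M.deltaR (x 1)) (γ ν : Fin 4) :
    partialDeriv 1 (fun y => M.coframe γ y ν) x =
  (let r := x 1
   let A := √(M.deltaR (x 1)); let u := √(M.U (x 1) (x 2)); let B := √(M.deltaTheta (x 2))
   let A' := M.dSqrtR (x 1)
   ![![A' / u - A * r / u ^ 3, 0, 0, (A' / u - A * r / u ^ 3) * -(M.a * sin (x 2) ^ 2 / M.E)],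
    ![0, r / u / A - u * A' / A ^ 2, 0, 0],
    ![0, 0, r / u / B, 0],
    ![-(B * r / u ^ 3) * sin (x 2) * M.a, 0, 0,
      (B * r / u ^ 3) * sin (x 2) * ((r ^ 2 + M.a ^ 2) / M.E)
        - B / u * sin (x 2) * (2 * r / M.E)]] γ ν) := by
  have hA := M.hasDerivAt_sqrt_deltaR hΔ
  have hu := M.hasDerivAt_sqrt_U_left hx (x 2)
  have hA0 : √(M.deltaR (x 1)) ≠ 0 := (Real.sqrt_pos.2 hΔ).ne'
  have hu0 : √(M.U (x 1) (x 2)) ≠ 0 := (Real.sqrt_pos.2 (M.U_pos hx _)).ne'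
  have hB0 : √(M.deltaTheta (x 2)) ≠ 0 := (Real.sqrt_pos.2 (M.deltaTheta_pos _)).ne'
  have hE : M.E ≠ 0 := M.E_pos.ne'
  have h0 := hA.div hu hu0
  have h1 := hu.div hA hA0
  have h2 := hu.div_const (√(M.deltaTheta (x 2)))
  have h3 := (hasDerivAt_const (x 1) (√(M.deltaTheta (x 2)))).div hu hu0
  have h4 := (hasDerivAt_pow 2 (x 1)).add_const (M.a ^ 2)
  unfold partialDeriv
  simp only [coframe_eq, Function.update_self,
    Function.update_of_ne (show (2 : Fin 4) ≠ 1 by decide)]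
  fin_cases γ <;> fin_cases ν <;> simp only [Fin.zero_eta, Fin.mk_one, Fin.reduceFinMk,
    Matrix.cons_val] <;> first
    | exact deriv_const _ _
    | skip
  · exact (h0.congr_deriv (by field_simp)).deriv
  · exact ((h0.mul_const _).congr_deriv (by field_simp)).deriv
  · exact (h1.congr_deriv (by field_simp)).deriv
  · exact h2.deriv
  · exact (((h3.mul_const (sin (x 2))).mul_const M.a).congr_deriv (by field_simp; ring)).deriv
  · exact (((h3.mul_const (sin (x 2))).mul (h4.div_const M.E).neg).congr_deriv
      (by simp; field_simp; ring)).deriv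

theorem partialDeriv_coframe_two (hx : 0 < x 1) (γ ν : Fin 4) :
    partialDeriv 2 (fun y => M.coframe γ y ν) x =
  (let r := x 1; let s := sin (x 2); let c := cos (x 2)
   let A := √(M.deltaR (x 1)); let u := √(M.U (x 1) (x 2)); let B := √(M.deltaTheta (x 2))
   let B' := M.dSqrtTheta (x 2)
   let f := B' / u * s + B * c / u + B * M.a ^ 2 * c * s ^ 2 / u ^ 3
   ![![A * M.a ^ 2 * c * s / u ^ 3, 0, 0,
      -(A * M.a ^ 2 * c * s / u ^ 3) * (M.a * s ^ 2 / M.E) - A / u * (2 * M.a * s * c / M.E)],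
    ![0, -(M.a ^ 2 * c * s) / u / A, 0, 0],
    ![0, 0, -(M.a ^ 2 * c * s) / u / B - u * B' / B ^ 2, 0],
    ![f * M.a, 0, 0, f * -((r ^ 2 + M.a ^ 2) / M.E)]] γ ν) := by
  have hB := M.hasDerivAt_sqrt_deltaTheta (x 2)
  have hu := M.hasDerivAt_sqrt_U_right hx (x 2)
  have hu0 : √(M.U (x 1) (x 2)) ≠ 0 := (Real.sqrt_pos.2 (M.U_pos hx _)).ne'
  have hB0 : √(M.deltaTheta (x 2)) ≠ 0 := (Real.sqrt_pos.2 (M.deltaTheta_pos _)).ne'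
  have hE : M.E ≠ 0 := M.E_pos.ne'
  have h0 := (hasDerivAt_const (x 2) (√(M.deltaR (x 1)))).div hu hu0
  have h1 := hu.div_const (√(M.deltaR (x 1)))
  have h2 := hu.div hB hB0
  have hs := Real.hasDerivAt_sin (x 2)
  have h3 := (hB.div hu hu0).mul hs
  have h4 := (((hs.pow 2).const_mul M.a).div_const M.E).neg
  unfold partialDeriv
  simp only [coframe_eq, Function.update_self,
    Function.update_of_ne (show (1 : Fin 4) ≠ 2 by decide)]
  fin_cases γ <;> fin_cases ν <;> simp only [Fin.zero_eta, Fin.mk_one, Fin.reduceFinMk,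
    Matrix.cons_val] <;> first
    | exact deriv_const _ _
    | skip
  · exact (h0.congr_deriv (by field_simp; ring)).deriv
  · exact ((h0.mul h4).congr_deriv (by simp; field_simp; ring)).deriv
  · exact h1.deriv
  · exact (h2.congr_deriv (by field_simp)).deriv
  · exact ((h3.mul_const _).congr_deriv (by simp only [Pi.div_apply]; field_simp; ring)).deriv
  · exact ((h3.mul_const _).congr_deriv (by simp only [Pi.div_apply]; field_simp; ring)).deriv

end Derivatives

end KerrNewmanAdS

/-! ### Cartan's structure equations and the spin connection term -/

namespace KerrNewmanAdS

section Cartan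

variable (M : KerrNewmanAdS) {x : Coord}

theorem dCoframe_skew (γ α β : Fin 4) (x : Coord) :
    M.dCoframe γ α β x = -M.dCoframe γ β α x := by
  unfold dCoframe
  rw [← mul_neg, Finset.sum_comm, ← Finset.sum_neg_distrib]
  congr 1
  refine Finset.sum_congr rfl fun μ _ => ?_
  rw [← Finset.sum_neg_distrib]
  refine Finset.sum_congr rfl fun ν _ => ?_
  ring

theorem dCoframe_self (γ α : Fin 4) (x : Coord) : M.dCoframe γ α α x = 0 := by
  have := M.dCoframe_skew γ α α x
  linarith

/-- The values `de_γ(e_α, e_β)` for `α < β`. -/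
theorem dCoframe_eq (h1 : 0 < x 1) (hΔ : 0 < M.deltaR (x 1)) (hs : sin (x 2) ≠ 0)
    (γ : Fin 4) :
    let r := x 1; let s := sin (x 2); let c := cos (x 2)
    let A := √(M.deltaR (x 1)); let u := √(M.U (x 1) (x 2)); let B := √(M.deltaTheta (x 2))
    let A' := M.dSqrtR (x 1); let B' := M.dSqrtTheta (x 2)
    M.dCoframe γ 0 1 x = ![A' / u - A * r / u ^ 3, 0, 0, 2 * M.a * r * s * B / u ^ 3] γ ∧
    M.dCoframe γ 0 2 x = ![-(B * M.a ^ 2 * s * c / u ^ 3), 0, 0, 0] γ ∧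
    M.dCoframe γ 0 3 x = 0 ∧
    M.dCoframe γ 1 2 x = ![0, B * M.a ^ 2 * s * c / u ^ 3, A * r / u ^ 3, 0] γ ∧
    M.dCoframe γ 1 3 x = ![0, 0, 0, A * r / u ^ 3] γ ∧
    M.dCoframe γ 2 3 x = ![-(2 * M.a * c * A / u ^ 3), 0, 0,
      B' / u + B * c / (u * s) + B * M.a ^ 2 * c * s / u ^ 3] γ := by
  intro r s c A u B A' B'
  have hA0 : A ≠ 0 := (Real.sqrt_pos.2 hΔ).ne'
  have hu0 : u ≠ 0 := (Real.sqrt_pos.2 (M.U_pos h1 _)).ne'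
  have hB0 : B ≠ 0 := (Real.sqrt_pos.2 (M.deltaTheta_pos _)).ne'
  have hE : M.E ≠ 0 := M.E_pos.ne'
  have hu2 : u ^ 2 = r ^ 2 + M.a ^ 2 * c ^ 2 := Real.sq_sqrt (M.U_nonneg _ _)
  have hs2 : r ^ 2 + M.a ^ 2 * c ^ 2 = r ^ 2 + M.a ^ 2 - M.a ^ 2 * s ^ 2 := by
    rw [Real.cos_sq']; ring
  have hu2' := hu2.trans hs2
  have hs' : s ≠ 0 := hs
  have hr : r ≠ 0 := h1.ne'
  refine ⟨?_, ?_, ?_, ?_, ?_, ?_⟩ <;> unfold dCoframe <;>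
  simp only [Fin.sum_univ_four, M.partialDeriv_coframe_zero, M.partialDeriv_coframe_three,
      M.partialDeriv_coframe_one h1 hΔ, M.partialDeriv_coframe_two h1, frame_eq M _ h1] <;>
  fin_cases γ <;> simp only [sign, Fin.zero_eta, Fin.mk_one, Fin.reduceFinMk,
    Matrix.cons_val, mul_zero, zero_mul, sub_zero, add_zero, zero_add, zero_sub] <;>
  try simp only [neg_zero, zero_mul, add_zero, mul_zero, neg_neg]
  all_goals simp only [show x 1 = r from rfl, show sin (x 2) = s from rfl,
    show cos (x 2) = c from rfl, show M.dSqrtR r = A' from rfl,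
    show M.dSqrtTheta (x 2) = B' from rfl,
    show √(M.deltaR r) = A from rfl, show √(M.U r (x 2)) = u from rfl,
    show √(M.deltaTheta (x 2)) = B from rfl]
  all_goals clear_value r s c A u B A' B'
  all_goals try field_simp
  -- The letters are now independent, and the goals that are not formal identities follow from the
  -- one relation `u² = r² + a² - a² s²`. The derivatives `A'` and `B'` are never evaluated, because
  -- `S₋` absorbs the first and the angular operator contains the second.
  all_goals first
    | done
    | ring1
    | linear_combination (A * r - A' * u ^ 2) * hu2'
    | linear_combination -(M.a ^ 2 * c) * hu2'
    | linear_combination hu2'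
    | linear_combination -(u ^ 2 * B' * s + u ^ 2 * B * c + s ^ 2 * B * c * M.a ^ 2) * hu2'

end Cartan

theorem gamma_mulVec (α : Fin 4) (v : Fin 4 → ℂ) : gamma α *ᵥ v =
    ![![-v 2, -v 3, -v 0, -v 1], ![-v 2, v 3, v 0, -v 1], ![v 3, v 2, -v 1, -v 0],
      ![Complex.I * v 3, -Complex.I * v 2, -Complex.I * v 1, Complex.I * v 0]] α := by
  fin_cases α <;> ext i <;> fin_cases i <;>
    simp [gamma, Matrix.mulVec, dotProduct, Fin.sum_univ_four]

/-- The zeroth-order part of the Dirac operator. -/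
theorem sum_gamma_connection (M : KerrNewmanAdS) {x : Coord}
    (h1 : 0 < x 1) (hΔ : 0 < M.deltaR (x 1)) (hs : sin (x 2) ≠ 0) (v : Fin 4 → ℂ) :
    let r := x 1; let s := sin (x 2); let c := cos (x 2)
    let A := √(M.deltaR (x 1)); let u := √(M.U (x 1) (x 2)); let B := √(M.deltaTheta (x 2))
    let A' := M.dSqrtR (x 1); let B' := M.dSqrtTheta (x 2)
    let p : ℂ := ((A * r / u ^ 3 + A' / u) / 2 : ℝ)
    let q : ℂ := ((B' / u + B * c / (u * s) - B * M.a ^ 2 * c * s / u ^ 3) / 2 : ℝ)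
    let y : ℂ := (M.a * c * A / (2 * u ^ 3) : ℝ)
    let z : ℂ := (M.a * r * s * B / (2 * u ^ 3) : ℝ)
    ∑ γ, gamma γ *ᵥ ((1 / 4 : ℂ) •
      ∑ α, ∑ β, (M.connection α β γ x : ℂ) • ((gamma α * gamma β) *ᵥ v)) =
    -![-(p + Complex.I * y) * v 2 + (q + Complex.I * z) * v 3,
       (p + Complex.I * y) * v 3 + (q + Complex.I * z) * v 2,
       (p - Complex.I * y) * v 0 + (-q + Complex.I * z) * v 1,
       (-p + Complex.I * y) * v 1 + (-q + Complex.I * z) * v 0] := by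
  intro r s c A u B A' B' p q y z
  have hD := M.dCoframe_eq h1 hΔ hs
  simp only [← Matrix.mulVec_mulVec]
  have e1 : ∀ γ, M.dCoframe γ 1 0 x = -M.dCoframe γ 0 1 x := fun γ => M.dCoframe_skew _ _ _ _
  have e2 : ∀ γ, M.dCoframe γ 2 0 x = -M.dCoframe γ 0 2 x := fun γ => M.dCoframe_skew _ _ _ _
  have e3 : ∀ γ, M.dCoframe γ 3 0 x = -M.dCoframe γ 0 3 x := fun γ => M.dCoframe_skew _ _ _ _
  have e4 : ∀ γ, M.dCoframe γ 2 1 x = -M.dCoframe γ 1 2 x := fun γ => M.dCoframe_skew _ _ _ _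
  have e5 : ∀ γ, M.dCoframe γ 3 1 x = -M.dCoframe γ 1 3 x := fun γ => M.dCoframe_skew _ _ _ _
  have e6 : ∀ γ, M.dCoframe γ 3 2 x = -M.dCoframe γ 2 3 x := fun γ => M.dCoframe_skew _ _ _ _
  have f1 := fun γ => (hD γ).1
  have f2 := fun γ => (hD γ).2.1
  have f3 := fun γ => (hD γ).2.2.1
  have f4 := fun γ => (hD γ).2.2.2.1
  have f5 := fun γ => (hD γ).2.2.2.2.1
  have f6 := fun γ => (hD γ).2.2.2.2.2
  simp only [connection, Fin.sum_univ_four, dCoframe_self, e1, e2, e3, e4, e5, e6, f1, f2, f3, f4,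
    f5, f6, Matrix.cons_val]
  simp only [show x 1 = r from rfl, show sin (x 2) = s from rfl,
    show cos (x 2) = c from rfl, show M.dSqrtR r = A' from rfl,
    show M.dSqrtTheta (x 2) = B' from rfl,
    show √(M.deltaR r) = A from rfl, show √(M.U r (x 2)) = u from rfl,
    show √(M.deltaTheta (x 2)) = B from rfl]
  subst p q y z
  clear_value r s c A u B A' B'
  simp only [neg_zero, add_zero, sub_zero, zero_add, zero_sub, neg_neg, sub_self, zero_div,
    Complex.ofReal_zero, zero_smul]
  simp only [gamma_mulVec, Matrix.cons_val]
  ext i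
  fin_cases i <;> simp [-mul_eq_mul_left_iff, -mul_eq_mul_right_iff] <;> ring_nf <;>
    simp only [Complex.I_sq] <;> ring

end KerrNewmanAdS

/-! ### The double root of `Δ₋` and the entries of `S₋` -/

namespace KerrNewmanAdS

theorem isOpen_exterior (re : ℝ) : IsOpen (exterior re) := by
  unfold exterior
  exact (isOpen_lt continuous_const (continuous_apply 1)).inter
    ((isOpen_lt continuous_const (continuous_apply 2)).inter
      (isOpen_lt (continuous_apply 2) continuous_const))

section Extreme

variable {M : KerrNewmanAdS} {re : ℝ}

/-- The quotient of `Δ₋(r)` by `(r - re)²` in the extreme case. -/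
noncomputable def cofactor (M : KerrNewmanAdS) (re r : ℝ) : ℝ :=
  M.κ ^ 2 * (r + re) ^ 2 + 2 * M.κ ^ 2 * re ^ 2 + 1 + M.κ ^ 2 * M.a ^ 2

theorem cofactor_pos (M : KerrNewmanAdS) (re r : ℝ) : 0 < M.cofactor re r := by
  unfold cofactor; positivity

theorem IsExtreme.deltaR_eq (h : M.IsExtreme re) (r : ℝ) :
    M.deltaR r = (r - re) ^ 2 * M.cofactor re r := by
  have hdvd := Polynomial.pow_rootMultiplicity_dvd M.deltaPoly re
  rw [h.2.1] at hdvd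
  obtain ⟨q, hq⟩ := hdvd
  have hfun : M.deltaR = fun s => (s - re) ^ 2 * q.eval s := by
    funext s
    rw [← M.eval_deltaPoly s, hq]
    simp
  have h0 : M.deltaR re = 0 := by rw [hfun]; simp
  have h1 := M.hasDerivAt_deltaR re
  have h2 : HasDerivAt M.deltaR 0 re := by
    rw [hfun]
    have := (((hasDerivAt_id re).sub_const re).pow 2).mul (q.hasDerivAt re)
    convert! this using 1
    simp
  have h3 := h1.unique h2
  unfold deltaR at h0 ⊢
  unfold cofactor
  -- Taylor expansion at `re`: value and slope vanish there, and the absence of a cubic term in the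
  -- quartic fixes the remaining quadratic as `cofactor`.
  linear_combination (r - re) * h3 + h0

theorem IsExtreme.deltaR_pos (h : M.IsExtreme re) {r : ℝ} (hr : re < r) : 0 < M.deltaR r := by
  rw [h.deltaR_eq]
  have := sub_pos.2 hr
  have := M.cofactor_pos re r
  positivity

theorem IsExtreme.sqrt_deltaR (h : M.IsExtreme re) {r : ℝ} (hr : re < r) :
    √(M.deltaR r) = (r - re) * √(M.cofactor re r) := by
  rw [h.deltaR_eq, Real.sqrt_mul (sq_nonneg _), Real.sqrt_sq (sub_pos.2 hr).le]

end Extreme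

/-- `Δ₋(r)^{1/4} (r + i b cos θ)^{1/2}`; the entries of `S₋` are the cases `b = ±a`. -/
noncomputable def spinScale (M : KerrNewmanAdS) (b r θ : ℝ) : ℂ :=
  ((M.deltaR r ^ (1 / 4 : ℝ) : ℝ) : ℂ) * ((r : ℂ) + Complex.I * b * cos θ) ^ (1 / 2 : ℂ)

section SpinScale

variable (M : KerrNewmanAdS) (b : ℝ) {r : ℝ} (θ : ℝ)

theorem rho_mem_slitPlane (hr : 0 < r) :
    (r : ℂ) + Complex.I * b * cos θ ∈ Complex.slitPlane := by
  left
  simp [hr, Complex.cos_ofReal_im]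

theorem rho_ne_zero (hr : 0 < r) : (r : ℂ) + Complex.I * b * cos θ ≠ 0 :=
  Complex.slitPlane_ne_zero (rho_mem_slitPlane b θ hr)

theorem spinScale_ne_zero (hr : 0 < r) (hΔ : 0 < M.deltaR r) : M.spinScale b r θ ≠ 0 := by
  unfold spinScale
  refine mul_ne_zero (Complex.ofReal_ne_zero.2 (Real.rpow_pos_of_pos hΔ _).ne') ?_
  rw [Complex.cpow_ne_zero_iff]
  exact Or.inl (rho_ne_zero b θ hr)

theorem rpow_quarter_eq {y : ℝ} (hy : 0 ≤ y) : y ^ (1 / 4 : ℝ) = √√y := by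
  rw [Real.sqrt_eq_rpow, Real.sqrt_eq_rpow, ← Real.rpow_mul hy]
  norm_num

theorem hasDerivAt_cpow_half {f : ℝ → ℂ} {f' : ℂ} {t : ℝ} (hf : HasDerivAt f f' t)
    (h : f t ∈ Complex.slitPlane) :
    HasDerivAt (fun s => f s ^ (1 / 2 : ℂ)) (f t ^ (1 / 2 : ℂ) * (f' / (2 * f t))) t := by
  have h1 : HasDerivAt (fun z : ℂ => z ^ (1 / 2 : ℂ)) _ (f t) :=
    (hasDerivAt_id (f t)).cpow_const (c := 1 / 2) h
  have h2 := h1.scomp t hf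
  refine h2.congr_deriv ?_
  have h0 := Complex.slitPlane_ne_zero h
  rw [Complex.cpow_sub _ _ (by exact h0)]
  simp
  field_simp

theorem hasDerivAt_spinScale_left (hr : 0 < r) (hΔ : 0 < M.deltaR r) :
    HasDerivAt (fun s => M.spinScale b s θ)
      (M.spinScale b r θ * (M.dSqrtR r / (2 * √(M.deltaR r)) +
        1 / (2 * ((r : ℂ) + Complex.I * b * cos θ)))) r := by
  have hA := M.hasDerivAt_sqrt_deltaR hΔ
  have hA0 := Real.sqrt_pos.2 hΔ
  have h1 : HasDerivAt (fun s => M.deltaR s ^ (1 / 4 : ℝ))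
      (M.deltaR r ^ (1 / 4 : ℝ) * (M.dSqrtR r / (2 * √(M.deltaR r)))) r := by
    have h2 := (hA.sqrt hA0.ne')
    have h3 : (fun s => M.deltaR s ^ (1 / 4 : ℝ)) =ᶠ[nhds r] fun s => √√(M.deltaR s) := by
      filter_upwards [(M.hasDerivAt_deltaR r).continuousAt.eventually (lt_mem_nhds hΔ)] with s hs
      exact rpow_quarter_eq (le_of_lt hs)
    refine (h2.congr_of_eventuallyEq h3).congr_deriv ?_
    rw [rpow_quarter_eq hΔ.le]
    have h4 : √√(M.deltaR r) ≠ 0 := (Real.sqrt_pos.2 hA0).ne'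
    have h5 := Real.sq_sqrt hA0.le
    field_simp
    rw [h5]
  have h2 : HasDerivAt (fun s : ℝ => (s : ℂ) + Complex.I * b * cos θ) 1 r :=
    (hasDerivAt_id r).ofReal_comp.add_const _
  have h3 := hasDerivAt_cpow_half h2 (rho_mem_slitPlane b θ hr)
  refine (h1.ofReal_comp.mul h3).congr_deriv ?_
  unfold spinScale
  push_cast
  ring

theorem hasDerivAt_spinScale_right (hr : 0 < r) :
    HasDerivAt (fun s => M.spinScale b r s)
      (M.spinScale b r θ *
        (-(Complex.I * b * sin θ) / (2 * ((r : ℂ) + Complex.I * b * cos θ)))) θ := by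
  have h2 : HasDerivAt (fun s : ℝ => (r : ℂ) + Complex.I * b * cos s)
      (-(Complex.I * b * sin θ)) θ := by
    refine (((Real.hasDerivAt_cos θ).ofReal_comp.const_mul (Complex.I * b)).const_add
      (r : ℂ)).congr_deriv ?_
    push_cast; ring
  have h3 := hasDerivAt_cpow_half h2 (rho_mem_slitPlane b θ hr)
  refine (h3.const_mul _).congr_deriv ?_
  unfold spinScale
  ring

theorem rho_mul_rho_neg :
    ((r : ℂ) + Complex.I * b * cos θ) * ((r : ℂ) + Complex.I * (-b : ℝ) * cos θ) =
      ((r ^ 2 + b ^ 2 * cos θ ^ 2 : ℝ) : ℂ) := by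
  push_cast
  linear_combination -(b : ℂ) ^ 2 * Complex.cos θ ^ 2 * Complex.I_sq

theorem norm_rho : ‖(r : ℂ) + Complex.I * b * cos θ‖ = √(r ^ 2 + b ^ 2 * cos θ ^ 2) := by
  have : (r : ℂ) + Complex.I * b * cos θ = (r : ℂ) + ((b * cos θ : ℝ) : ℂ) * Complex.I := by
    push_cast; ring
  rw [this, Complex.norm_add_mul_I]
  congr 1; ring

/-- The mass term couples components scaled by `ρ^{1/2}` to components scaled by `ρ̄^{1/2}`, and
this identity converts one scaling into the other. It rests on `√ρ̄` being the conjugate of `√ρ`,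
valid since `Re ρ = r > 0` keeps `ρ` off the branch cut. -/
theorem spinScale_neg_mul (hr : 0 < r) :
    M.spinScale (-b) r θ * (√(r ^ 2 + b ^ 2 * cos θ ^ 2) : ℝ) =
      M.spinScale b r θ * ((r : ℂ) + Complex.I * (-b : ℝ) * cos θ) := by
  obtain ⟨ρ, hρ⟩ : ∃ ρ, ρ = (r : ℂ) + Complex.I * b * cos θ := ⟨_, rfl⟩
  have hmem : ρ ∈ Complex.slitPlane := hρ ▸ rho_mem_slitPlane b θ hr
  have hconj : (r : ℂ) + Complex.I * (-b : ℝ) * cos θ = (starRingEnd ℂ) ρ := by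
    simp [hρ]
    simp [← Complex.ofReal_cos]
  have hc : (starRingEnd ℂ) ρ ^ (1 / 2 : ℂ) = (starRingEnd ℂ) (ρ ^ (1 / 2 : ℂ)) := by
    have := Complex.conj_cpow ρ (1 / 2) (Complex.slitPlane_arg_ne_pi hmem)
    simpa only [map_div₀, map_one, map_ofNat] using this
  have hsq : ρ ^ (1 / 2 : ℂ) * ρ ^ (1 / 2 : ℂ) = ρ := by
    rw [← Complex.cpow_add _ _ (Complex.slitPlane_ne_zero hmem)]
    norm_num
  have hn : ρ ^ (1 / 2 : ℂ) * (starRingEnd ℂ) (ρ ^ (1 / 2 : ℂ)) =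
      (√(r ^ 2 + b ^ 2 * cos θ ^ 2) : ℝ) := by
    rw [Complex.mul_conj, Complex.normSq_eq_norm_sq, ← norm_rho, ← hρ, sq, ← norm_mul, hsq]
  have hsq' : (starRingEnd ℂ) ρ =
      (starRingEnd ℂ) (ρ ^ (1 / 2 : ℂ)) * (starRingEnd ℂ) (ρ ^ (1 / 2 : ℂ)) := by
    rw [← map_mul, hsq]
  unfold spinScale
  rw [hconj, ← hρ, hc, ← hn, hsq']
  ring

theorem norm_spinScale (hΔ : 0 < M.deltaR r) :
    ‖M.spinScale b r θ‖ = √√(M.deltaR r) * √√(r ^ 2 + b ^ 2 * cos θ ^ 2) := by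
  unfold spinScale
  rw [norm_mul, rpow_quarter_eq hΔ.le, Complex.norm_real, Real.norm_of_nonneg (Real.sqrt_nonneg _)]
  congr 1
  rw [← norm_rho, Real.sqrt_eq_rpow ‖_‖]
  simpa using Complex.norm_cpow_real ((r : ℂ) + Complex.I * b * cos θ) (1 / 2)

end SpinScale

end KerrNewmanAdS

/-! ### Derivatives of a separated spinor and the potential in the frame -/

namespace KerrNewmanAdS

theorem spinScale_mul_apply (M : KerrNewmanAdS) {x : Coord} (hx : 0 < x 1)
    (hΔ : 0 < M.deltaR (x 1)) {v w : Fin 4 → ℂ} (h : v = (M.scaling x)⁻¹ *ᵥ w) (i : Fin 4) :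
    M.spinScale (![M.a, M.a, -M.a, -M.a] i) (x 1) (x 2) * v i = w i := by
  have hS : M.scaling x = Matrix.diagonal
      fun i => M.spinScale (![M.a, M.a, -M.a, -M.a] i) (x 1) (x 2) := by
    unfold scaling spinScale
    rw [← Matrix.diagonal_smul]
    congr 1
    ext j
    fin_cases j <;> simp [sub_eq_add_neg]
  have hdet : IsUnit (M.scaling x).det := by
    rw [hS, Matrix.det_diagonal, isUnit_iff_ne_zero]
    exact Finset.prod_ne_zero_iff.2 fun i _ => M.spinScale_ne_zero _ _ hx hΔ
  have : M.scaling x *ᵥ v = w := by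
    rw [h, Matrix.mulVec_mulVec, Matrix.mul_nonsing_inv _ hdet, Matrix.one_mulVec]
  rw [hS] at this
  rw [← this, Matrix.mulVec_diagonal]

theorem partialDeriv_apply {Ψ : SpinorField} {x : Coord} (h : DifferentiableAt ℝ Ψ x)
    (μ i : Fin 4) : partialDeriv μ Ψ x i = partialDeriv μ (fun y => Ψ y i) x := by
  unfold partialDeriv
  have h1 : DifferentiableAt ℝ (fun s : ℝ => Ψ (Function.update x μ s)) (x μ) := by
    refine DifferentiableAt.comp (x μ) (by simpa using h) ?_
    exact (hasDerivAt_update x μ (x μ)).differentiableAt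
  have := deriv_pi (φ := fun s : ℝ => Ψ (Function.update x μ s)) (x := x μ)
    (fun i => (differentiableAt_pi.1 h1) i)
  rw [this]

theorem hasDerivAt_update_of_differentiableAt {F : Coord → ℂ} {x : Coord}
    (h : DifferentiableAt ℝ F x) (μ : Fin 4) :
    HasDerivAt (fun s : ℝ => F (Function.update x μ s)) (partialDeriv μ F x) (x μ) := by
  have h1 : DifferentiableAt ℝ (fun s : ℝ => F (Function.update x μ s)) (x μ) := by
    refine DifferentiableAt.comp (x μ) (by simpa using h) ?_
    exact (hasDerivAt_update x μ (x μ)).differentiableAt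
  exact h1.hasDerivAt

/-- The partial derivatives of a component of a separated spinor. -/
theorem separated_component (M : KerrNewmanAdS) {re : ℝ} (hre : 0 < re)
    (hΔ : ∀ r, re < r → 0 < M.deltaR r) {F : Coord → ℂ} {b ω : ℝ} {k : ℤ} {X Y : ℝ → ℂ}
    (hF : ∀ y ∈ exterior re, M.spinScale b (y 1) (y 2) * F y =
      Complex.exp (-Complex.I * (ω * y 0 + ((k : ℂ) + 1 / 2) * y 3)) * (X (y 1) * Y (y 2)))
    {r θ : ℝ} (hr : re < r) (hθ : 0 < θ) (hθ' : θ < π)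
    (hd : DifferentiableAt ℝ F ![0, r, θ, 0]) :
    let x : Coord := ![0, r, θ, 0]
    let σ := M.spinScale b r θ
    let ρ := (r : ℂ) + Complex.I * b * cos θ
    σ * F x = X r * Y θ ∧
    partialDeriv 0 F x = -Complex.I * ω * F x ∧
    σ * partialDeriv 1 F x =
      deriv X r * Y θ - (M.dSqrtR r / (2 * √(M.deltaR r)) + 1 / (2 * ρ)) * (X r * Y θ) ∧
    σ * partialDeriv 2 F x =
      X r * deriv Y θ + Complex.I * b * sin θ / (2 * ρ) * (X r * Y θ) ∧
    partialDeriv 3 F x = -Complex.I * (k + 1 / 2) * F x := by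
  intro x σ ρ
  have hr0 : 0 < r := hre.trans hr
  have hΔr := hΔ r hr
  have hσ : σ ≠ 0 := M.spinScale_ne_zero b θ hr0 hΔr
  have hx : x ∈ exterior re := ⟨hr, hθ, hθ'⟩
  have hFx : σ * F x = X r * Y θ := by
    have := hF x hx
    simpa [x] using this
  have u0 : ∀ s, Function.update x 0 s = ![s, r, θ, 0] := by
    intro s; ext j; fin_cases j <;> simp [x]
  have u1 : ∀ s, Function.update x 1 s = ![0, s, θ, 0] := by
    intro s; ext j; fin_cases j <;> simp [x]
  have u2 : ∀ s, Function.update x 2 s = ![0, r, s, 0] := by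
    intro s; ext j; fin_cases j <;> simp [x]
  have u3 : ∀ s, Function.update x 3 s = ![0, r, θ, s] := by
    intro s; ext j; fin_cases j <;> simp [x]
  have d0 := hasDerivAt_update_of_differentiableAt hd 0
  have d1 := hasDerivAt_update_of_differentiableAt hd 1
  have d2 := hasDerivAt_update_of_differentiableAt hd 2
  have d3 := hasDerivAt_update_of_differentiableAt hd 3
  have hexp : ∀ z : ℂ, HasDerivAt (fun s : ℝ => Complex.exp (z * s) * F x) (z * F x) 0 := by
    intro z
    have := (((hasDerivAt_id (0 : ℝ)).ofReal_comp.const_mul z).cexp).mul_const (F x)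
    simpa using this
  refine ⟨hFx, ?_, ?_, ?_, ?_⟩
  · have h : (fun s : ℝ => F (Function.update x 0 s)) =
        fun s : ℝ => Complex.exp (-Complex.I * ω * s) * F x := by
      funext s
      rw [u0]
      have := hF ![s, r, θ, 0] ⟨hr, hθ, hθ'⟩
      refine mul_left_cancel₀ hσ ?_
      rw [mul_left_comm, hFx]
      simpa [mul_assoc] using this
    change HasDerivAt (fun s : ℝ => F (Function.update x 0 s)) _ (0 : ℝ) at d0
    rw [h] at d0
    exact d0.unique (hexp _)
  · change HasDerivAt (fun s : ℝ => F (Function.update x 1 s)) _ r at d1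
    have h1 := (M.hasDerivAt_spinScale_left b θ hr0 hΔr).mul d1
    have h2 : (fun s => M.spinScale b s θ) * (fun s : ℝ => F (Function.update x 1 s))
        =ᶠ[nhds r] fun s => X s * Y θ := by
      filter_upwards [lt_mem_nhds hr] with s hs
      have := hF ![0, s, θ, 0] ⟨hs, hθ, hθ'⟩
      simpa [u1] using this
    have h3 := h1.deriv
    -- `X` is not known to be differentiable by itself. Over a field a constant factor leaves
    -- `deriv` unconditionally, even when it is zero.
    rw [h2.deriv_eq, deriv_mul_const_field] at h3
    simp only [u1] at h3
    change _ = _ + σ * partialDeriv 1 F x at h3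
    rw [h3, ← hFx]
    simp only [x, σ, ρ]
    push_cast
    ring
  · change HasDerivAt (fun s : ℝ => F (Function.update x 2 s)) _ θ at d2
    have h1 := (M.hasDerivAt_spinScale_right b θ hr0).mul d2
    have h2 : (fun s => M.spinScale b r s) * (fun s : ℝ => F (Function.update x 2 s))
        =ᶠ[nhds θ] fun s => X r * Y s := by
      filter_upwards [lt_mem_nhds hθ, gt_mem_nhds hθ'] with s hs hs'
      have := hF ![0, r, s, 0] ⟨hr, hs, hs'⟩
      simpa [u2] using this
    have h3 := h1.deriv
    rw [h2.deriv_eq, deriv_const_mul_field] at h3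
    simp only [u2] at h3
    change _ = _ + σ * partialDeriv 2 F x at h3
    rw [h3, ← hFx]
    simp only [x, σ, ρ]
    push_cast
    ring
  · have h : (fun s : ℝ => F (Function.update x 3 s)) =
        fun s : ℝ => Complex.exp (-Complex.I * (k + 1 / 2) * s) * F x := by
      funext s
      rw [u3]
      have := hF ![0, r, θ, s] ⟨hr, hθ, hθ'⟩
      refine mul_left_cancel₀ hσ ?_
      rw [mul_left_comm, hFx]
      simpa [mul_assoc] using this
    change HasDerivAt (fun s : ℝ => F (Function.update x 3 s)) _ (0 : ℝ) at d3
    rw [h] at d3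
    exact d3.unique (hexp _)

/-- The two brackets in `A` are multiples of `e⁰` and `e³`, so `Q` enters only the radial part and
`P` only the angular part. -/
theorem potentialFrame_eq (M : KerrNewmanAdS) (α : Fin 4) {x : Coord} (h1 : 0 < x 1)
    (hΔ : 0 < M.deltaR (x 1)) (hs : sin (x 2) ≠ 0) :
    M.potentialFrame α x =
      ![-(M.Q * x 1) / (√(M.U (x 1) (x 2)) * √(M.deltaR (x 1))), 0, 0,
        -(M.P * cos (x 2)) / (√(M.U (x 1) (x 2)) * √(M.deltaTheta (x 2)) * sin (x 2))] α := by
  have hA0 : √(M.deltaR (x 1)) ≠ 0 := (Real.sqrt_pos.2 hΔ).ne'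
  have hu0 : √(M.U (x 1) (x 2)) ≠ 0 := (Real.sqrt_pos.2 (M.U_pos h1 _)).ne'
  have hB0 : √(M.deltaTheta (x 2)) ≠ 0 := (Real.sqrt_pos.2 (M.deltaTheta_pos _)).ne'
  have hE : M.E ≠ 0 := M.E_pos.ne'
  have hU : M.U (x 1) (x 2) ≠ 0 := (M.U_pos h1 _).ne'
  have hU' : M.U (x 1) (x 2) = x 1 ^ 2 + M.a ^ 2 - M.a ^ 2 * sin (x 2) ^ 2 := by
    unfold U; rw [Real.cos_sq']; ring
  simp only [potentialFrame, Fin.sum_univ_four, frame_eq M _ h1, potential]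
  fin_cases α <;> simp only [Fin.zero_eta, Fin.mk_one, Fin.reduceFinMk, Matrix.cons_val]
  · field_simp
    linear_combination M.Q * x 1 * hU'
  · simp
  · simp
  · field_simp
    linear_combination M.P * cos (x 2) * hU'

end KerrNewmanAdS

/-! ### Reduction of the Dirac equation to scalar equations -/

namespace KerrNewmanAdS

/-- The purpose of `S₋`: the terms `ℓ + 1/(2ρ)` and `i b s/(2ρ)` of the spin connection are the
negatives of those produced by differentiating `S₋⁻¹`, so they cancel. What is left has the radial
operator acting on one factor and the angular operator on the other. Here `σ` and `σ'` are two
entries of `S₋`, `u = √U`, and `τ`, `μ` collect the `t`, `φ` and potential terms. -/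
theorem row_of_scaled_row {σ σ' u A ℓ B b s ρ τ n μ l ε₁ ε₂ v d₁ w d₂ z X X' Y X₂ Y₂ Y₂' X₃ Y₃ : ℂ}
    (h : ε₁ * (A * d₁ + (A * ℓ + A / (2 * ρ) + τ) * v) +
      ε₂ * (B * d₂ + (n - Complex.I * b * s * B / (2 * ρ) + μ) * w) +
      Complex.I * l * u * z = 0)
    (hv : σ * v = X * Y) (hd₁ : σ * d₁ = X' * Y - (ℓ + 1 / (2 * ρ)) * (X * Y))
    (hw : σ * w = X₂ * Y₂)
    (hd₂ : σ * d₂ = X₂ * Y₂' + Complex.I * b * s / (2 * ρ) * (X₂ * Y₂))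
    (hσ : σ * u = σ' * ρ) (hz : σ' * z = X₃ * Y₃) :
    ε₁ * (A * X' + τ * X) * Y + ε₂ * (B * Y₂' + (n + μ) * Y₂) * X₂ +
      Complex.I * l * ρ * (X₃ * Y₃) = 0 := by
  linear_combination σ * h - ε₁ * A * hd₁ - ε₁ * (A * ℓ + A / (2 * ρ) + τ) * hv - ε₂ * B * hd₂ -
    ε₂ * (n - Complex.I * b * s * B / (2 * ρ) + μ) * hw - Complex.I * l * z * hσ -
    Complex.I * l * ρ * hz

/-- The potential term `W(r) = ω(r² + a²) + (k + ½)E₋a + rQ` of the radial equation. -/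
noncomputable def radialPotential (M : KerrNewmanAdS) (ω : ℝ) (k : ℤ) (r : ℝ) : ℝ :=
  ω * (r ^ 2 + M.a ^ 2) + ((k : ℝ) + 1 / 2) * M.E * M.a + r * M.Q

/-- The angular operators, evaluated on the values `Y θ` and `Y' θ`; `ε = ±1`. -/
noncomputable def angular (M : KerrNewmanAdS) (ω : ℝ) (k : ℤ) (ε : ℂ) (θ : ℝ) (Y Y' : ℂ) : ℂ :=
  √(M.deltaTheta θ) * Y' +
    ((M.dSqrtTheta θ / 2 + √(M.deltaTheta θ) * cos θ / (2 * sin θ)) +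
      ε * (-(M.a * ω * sin θ + M.E * (k + 1 / 2) / sin θ) + M.P * cos θ / sin θ)
        / √(M.deltaTheta θ)) * Y

/-- The equations are the rows of the Dirac equation at `t = φ = 0`, where the exponential is `1`.
The first and third share the factor `Y₋`, the second and fourth `Y₊`; each pair is a closed radial
system once `θ` is fixed. -/
theorem separated_system (M : KerrNewmanAdS) {re : ℝ} (hre : 0 < re)
    (hΔ : ∀ r, re < r → 0 < M.deltaR r) {lam ω : ℝ} {k : ℤ} {Xp Xm Yp Ym : ℝ → ℂ}
    {Ψ : SpinorField}
    (hform : ∀ x ∈ exterior re, Ψ x = (M.scaling x)⁻¹ *ᵥ separated ω k Xp Xm Yp Ym x)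
    (hsol : M.IsDiracSolution re lam Ψ) {r θ : ℝ} (hr : re < r) (hθ : 0 < θ) (hθ' : θ < π) :
    let A : ℂ := √(M.deltaR r)
    let W : ℂ := M.radialPotential ω k r
    let ρ (b : ℝ) := (r : ℂ) + Complex.I * b * cos θ
    (-1) * (A * deriv Xp r + -Complex.I * W / A * Xp r) * Ym θ +
      1 * M.angular ω k 1 θ (Yp θ) (deriv Yp θ) * Xm r +
      Complex.I * lam * ρ (-M.a) * (Xm r * Ym θ) = 0 ∧
    1 * (A * deriv Xm r + Complex.I * W / A * Xm r) * Yp θ +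
      1 * M.angular ω k (-1) θ (Ym θ) (deriv Ym θ) * Xp r +
      Complex.I * lam * ρ (-M.a) * (Xp r * Yp θ) = 0 ∧
    1 * (A * deriv Xm r + Complex.I * W / A * Xm r) * Ym θ +
      (-1) * M.angular ω k 1 θ (Yp θ) (deriv Yp θ) * Xp r +
      Complex.I * lam * ρ M.a * (Xp r * Ym θ) = 0 ∧
    (-1) * (A * deriv Xp r + -Complex.I * W / A * Xp r) * Yp θ +
      (-1) * M.angular ω k (-1) θ (Ym θ) (deriv Ym θ) * Xm r +
      Complex.I * lam * ρ M.a * (Xm r * Yp θ) = 0 := by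
  intro A W ρ
  obtain ⟨x, hx⟩ : ∃ x : Coord, x = ![0, r, θ, 0] := ⟨_, rfl⟩
  have x1 : x 1 = r := by simp [hx]
  have x2 : x 2 = θ := by simp [hx]
  have hxe : x ∈ exterior re := ⟨by rwa [x1], by rwa [x2], by rwa [x2]⟩
  have hr0 : 0 < r := hre.trans hr
  have hΔr := hΔ r hr
  have hs : sin θ ≠ 0 := (Real.sin_pos_of_pos_of_lt_pi hθ hθ').ne'
  have hd : DifferentiableAt ℝ Ψ x := hsol.1.differentiableAt ((isOpen_exterior re).mem_nhds hxe)
  have hmul : ∀ y ∈ exterior re, ∀ i,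
      M.spinScale (![M.a, M.a, -M.a, -M.a] i) (y 1) (y 2) * Ψ y i =
        separated ω k Xp Xm Yp Ym y i := fun y hy i =>
    M.spinScale_mul_apply (hre.trans hy.1) (hΔ _ hy.1) (hform y hy) i
  have hdi : ∀ i, DifferentiableAt ℝ (fun y => Ψ y i) x := differentiableAt_pi.1 hd
  have hsep : ∀ y ∈ exterior re, ∀ i, separated ω k Xp Xm Yp Ym y i =
      Complex.exp (-Complex.I * (ω * y 0 + ((k : ℂ) + 1 / 2) * y 3)) *
        (![Xm, Xp, Xp, Xm] i (y 1) * ![Ym, Yp, Ym, Yp] i (y 2)) := by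
    intro y _ i
    fin_cases i <;> simp [separated]
  have hcomp := fun i : Fin 4 => M.separated_component (F := fun y => Ψ y i)
    (b := ![M.a, M.a, -M.a, -M.a] i) (ω := ω) (k := k) (X := ![Xm, Xp, Xp, Xm] i)
    (Y := ![Ym, Yp, Ym, Yp] i) hre hΔ
    (fun y hy => (hmul y hy i).trans (hsep y hy i)) hr hθ hθ' (hx ▸ hdi i)
  simp only [← hx, ← partialDeriv_apply hd] at hcomp
  have hdir := hsol.2 x hxe
  have hconn := M.sum_gamma_connection (x := x) (by rwa [x1]) (by rwa [x1]) (by rwa [x2]) (Ψ x)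
  simp only [x1, x2] at hconn
  have c0 := hcomp 0
  have c1 := hcomp 1
  have c2 := hcomp 2
  have c3 := hcomp 3
  simp only [Matrix.cons_val] at c0 c1 c2 c3
  obtain ⟨v0, t0, r0, θ0, φ0⟩ := c0
  obtain ⟨v1, t1, r1, θ1, φ1⟩ := c1
  obtain ⟨v2, t2, r2, θ2, φ2⟩ := c2
  obtain ⟨v3, t3, r3, θ3, φ3⟩ := c3
  have hA : A ≠ 0 := Complex.ofReal_ne_zero.2 (Real.sqrt_pos.2 hΔr).ne'
  have hu : (√(M.U r θ) : ℂ) ≠ 0 := Complex.ofReal_ne_zero.2 (Real.sqrt_pos.2 (M.U_pos hr0 _)).ne'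
  have hB : (√(M.deltaTheta θ) : ℂ) ≠ 0 :=
    Complex.ofReal_ne_zero.2 (Real.sqrt_pos.2 (M.deltaTheta_pos _)).ne'
  have hs' : (sin θ : ℂ) ≠ 0 := Complex.ofReal_ne_zero.2 hs
  have hρ : (r : ℂ) + Complex.I * M.a * cos θ ≠ 0 := rho_ne_zero _ _ hr0
  have hρ' : (r : ℂ) + Complex.I * (-M.a : ℝ) * cos θ ≠ 0 := rho_ne_zero _ _ hr0
  have huu : ((r : ℂ) + Complex.I * M.a * cos θ) * ((r : ℂ) + Complex.I * (-M.a : ℝ) * cos θ) =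
      (√(M.U r θ) : ℂ) ^ 2 := by
    rw [rho_mul_rho_neg]; rw [← Complex.ofReal_pow, Real.sq_sqrt (M.U_nonneg _ _)]; rfl
  have σ1 : M.spinScale (-M.a) r θ * (√(M.U r θ) : ℝ) =
      M.spinScale M.a r θ * ((r : ℂ) + Complex.I * (-M.a : ℝ) * cos θ) :=
    M.spinScale_neg_mul M.a θ hr0
  have σ2 : M.spinScale M.a r θ * (√(M.U r θ) : ℝ) =
      M.spinScale (-M.a) r θ * ((r : ℂ) + Complex.I * M.a * cos θ) := by
    simpa [U] using M.spinScale_neg_mul (-M.a) θ hr0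
  obtain ⟨ρ₁, hρ₁⟩ : ∃ z, z = (r : ℂ) + Complex.I * M.a * cos θ := ⟨_, rfl⟩
  obtain ⟨ρ₂, hρ₂⟩ : ∃ z, z = (r : ℂ) + Complex.I * (-M.a : ℝ) * cos θ := ⟨_, rfl⟩
  rw [← hρ₁] at hρ huu
  rw [← hρ₂] at hρ' huu
  -- Partial fractions from `U = ρ₁ρ₂`. In the combinations `p ± iy` and `±q + iz` that occur in the
  -- rows, only one of `1/ρ₁`, `1/ρ₂` survives: the one belonging to the scaling of the component it
  -- multiplies.
  have hp : (((√(M.deltaR r) * r / √(M.U r θ) ^ 3 + M.dSqrtR r / √(M.U r θ)) / 2 : ℝ) : ℂ) =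
      A * (2 * (M.dSqrtR r / (2 * A)) + 1 / (2 * ρ₁) + 1 / (2 * ρ₂)) / (2 * √(M.U r θ)) := by
    push_cast
    change (A * _ / _ + _) / _ = _
    field_simp
    rw [← huu, hρ₁, hρ₂]
    push_cast
    ring
  have hy : Complex.I * ((M.a * cos θ * √(M.deltaR r) / (2 * √(M.U r θ) ^ 3) : ℝ) : ℂ) =
      A * (1 / (2 * ρ₂) - 1 / (2 * ρ₁)) / (2 * √(M.U r θ)) := by
    push_cast
    change _ * (_ * A / _) = _
    field_simp
    rw [← huu, hρ₁, hρ₂]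
    push_cast
    ring
  have hq : (((M.dSqrtTheta θ / √(M.U r θ) + √(M.deltaTheta θ) * cos θ / (√(M.U r θ) * sin θ) -
      √(M.deltaTheta θ) * M.a ^ 2 * cos θ * sin θ / √(M.U r θ) ^ 3) / 2 : ℝ) : ℂ) =
      (M.dSqrtTheta θ / 2 + √(M.deltaTheta θ) * cos θ / (2 * sin θ) +
        Complex.I * M.a * sin θ * √(M.deltaTheta θ) * (1 / (2 * ρ₂) - 1 / (2 * ρ₁)) / 2) /
        √(M.U r θ) := by
    push_cast
    field_simp
    rw [show (√(M.U r θ) : ℂ) ^ 2 = _ from huu.symm, hρ₁, hρ₂]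
    push_cast
    ring_nf
    simp only [Complex.I_sq, Complex.I_pow_four]
    ring
  have hz : Complex.I * ((M.a * r * sin θ * √(M.deltaTheta θ) / (2 * √(M.U r θ) ^ 3) : ℝ) : ℂ) =
      Complex.I * M.a * sin θ * √(M.deltaTheta θ) * (1 / (2 * ρ₂) + 1 / (2 * ρ₁)) /
        (2 * √(M.U r θ)) := by
    push_cast
    field_simp
    rw [← huu, hρ₁, hρ₂]
    push_cast
    ring
  rw [hp, hy, hq, hz] at hconn
  unfold dirac spinDeriv at hdir
  simp only [Matrix.mulVec_sub, Finset.sum_sub_distrib] at hdir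
  rw [hconn] at hdir
  clear hconn
  simp only [Fin.sum_univ_four, frame_eq M _ (x1 ▸ hr0 : 0 < x 1),
    M.potentialFrame_eq _ (x1 ▸ hr0 : 0 < x 1) (x1 ▸ hΔr : 0 < M.deltaR (x 1))
      (x2 ▸ hs : sin (x 2) ≠ 0), x1, x2, gamma_mulVec, Matrix.cons_val] at hdir
  have g0 := congrFun hdir 0
  have g1 := congrFun hdir 1
  have g2 := congrFun hdir 2
  have g3 := congrFun hdir 3
  clear hdir hform hmul hcomp hsol hd hdi hsep hp hy hq hz hΔ
  simp only [Pi.add_apply, Pi.sub_apply, Pi.neg_apply, Pi.smul_apply, Pi.zero_apply,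
    Matrix.cons_val, smul_eq_mul, t0, t1, t2, t3, φ0, φ1, φ2, φ3] at g0 g1 g2 g3
  refine ⟨row_of_scaled_row ?_ v2 r2 v3 θ3 σ1 v0, row_of_scaled_row ?_ v3 r3 v2 θ2 σ1 v1,
    row_of_scaled_row ?_ v0 r0 v1 θ1 σ2 v2, row_of_scaled_row ?_ v1 r1 v0 θ0 σ2 v3⟩
  all_goals simp only [ρ, ← hρ₁, ← hρ₂, W, radialPotential]
  all_goals clear σ1 σ2 v0 v1 v2 v3 t0 t1 t2 t3 r0 r1 r2 r3 θ0 θ1 θ2 θ3 φ0 φ1 φ2 φ3 huu hρ₁ hρ₂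
  all_goals simp only [show (√(M.deltaR r) : ℂ) = A from rfl, Complex.ofReal_zero, zero_mul, add_zero, zero_add, Complex.ofReal_div, Complex.ofReal_mul, Complex.ofReal_neg,
    Complex.ofReal_add, Complex.ofReal_pow, Complex.ofReal_intCast, Complex.ofReal_one,
    Complex.ofReal_ofNat] at g0 g1 g2 g3 ⊢
  any_goals clear_value A
  · linear_combination (norm := skip) √(M.U r θ) * g0
    field_simp
    ring_nf
    simp only [Complex.I_sq]
    ring
  · linear_combination (norm := skip) √(M.U r θ) * g1
    field_simp
    ring_nf
    simp only [Complex.I_sq]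
    ring
  · linear_combination (norm := skip) √(M.U r θ) * g2
    field_simp
    ring_nf
    simp only [Complex.I_sq]
    ring
  · linear_combination (norm := skip) √(M.U r θ) * g3
    field_simp
    ring_nf
    simp only [Complex.I_sq]
    ring

end KerrNewmanAdS

/-! ### The radial system at its irregular singular point -/

/-- Gronwall's inequality read from right to left: an upper bound on the growth rate carries a lower
bound inward, towards the horizon. -/
theorem mul_exp_le_of_deriv_le_mul {f f' : ℝ → ℝ} {C x b : ℝ} (hxb : x ≤ b)
    (hf : ∀ r ∈ Set.Icc x b, HasDerivAt f (f' r) r)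
    (hle : ∀ r ∈ Set.Icc x b, f' r ≤ C * f r) : f b * rexp (-C * (b - x)) ≤ f x := by
  have hg : ∀ r ∈ Set.Icc x b, HasDerivAt (fun s => f s * rexp (-C * (s - x)))
      (f' r * rexp (-C * (r - x)) + f r * (rexp (-C * (r - x)) * (-C * 1))) r := fun r hr =>
    (hf r hr).mul ((((hasDerivAt_id r).sub_const x).const_mul (-C)).exp)
  have hanti : AntitoneOn (fun s => f s * rexp (-C * (s - x))) (Set.Icc x b) := by
    refine antitoneOn_of_deriv_nonpos (convex_Icc x b)
      (fun r hr => (hg r hr).continuousAt.continuousWithinAt)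
      (fun r hr => (hg r (interior_subset hr)).differentiableAt.differentiableWithinAt) ?_
    intro r hr
    have hr' := interior_subset hr
    rw [(hg r hr').deriv]
    have := hle r hr'
    have h0 := Real.exp_pos (-C * (r - x))
    nlinarith
  simpa using hanti (Set.left_mem_Icc.2 hxb) (Set.right_mem_Icc.2 hxb) hxb

theorem Complex.norm_mul_conj_le (z w : ℂ) :
    ‖z * (starRingEnd ℂ) w‖ ≤ (‖w‖ ^ 2 + ‖z‖ ^ 2) / 2 := by
  rw [norm_mul, RCLike.norm_conj]
  nlinarith [sq_nonneg (‖z‖ - ‖w‖)]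

section RadialSystem

variable {re : ℝ} {A W : ℝ → ℝ} {q₁ q₂ Xp Xm : ℝ → ℂ}

/-- The terms `±iW/A` are imaginary and drop out of the derivative of the squared moduli; only the
off-diagonal coupling remains. -/
theorem hasDerivAt_energy {r : ℝ} (hA : A r ≠ 0)
    (hXp : DifferentiableAt ℝ Xp r) (hXm : DifferentiableAt ℝ Xm r)
    (ep : A r * deriv Xp r + -Complex.I * W r / A r * Xp r = q₁ r * Xm r)
    (em : A r * deriv Xm r + Complex.I * W r / A r * Xm r = q₂ r * Xp r) :
    HasDerivAt (fun s => ‖Xp s‖ ^ 2 + ‖Xm s‖ ^ 2)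
      (2 * (q₁ r + (starRingEnd ℂ) (q₂ r)) * (Xm r * (starRingEnd ℂ) (Xp r)) / A r).re r := by
  have hA' : (A r : ℂ) ≠ 0 := Complex.ofReal_ne_zero.2 hA
  have dp : deriv Xp r = (q₁ r * Xm r + Complex.I * W r / A r * Xp r) / A r := by
    rw [eq_div_iff hA']; linear_combination ep
  have dm : deriv Xm r = (q₂ r * Xp r - Complex.I * W r / A r * Xm r) / A r := by
    rw [eq_div_iff hA']; linear_combination em
  refine (hXp.hasDerivAt.norm_sq.add hXm.hasDerivAt.norm_sq).congr_deriv ?_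
  rw [dp, dm]
  simp [Complex.inner, Complex.div_re, Complex.div_im, Complex.normSq_apply]
  field_simp
  ring

/-- For `Z = X₋ conj X₊` one has `Z' = -2i(W/A²) Z + (q₂|X₊|² + conj q₁ |X₋|²)/A`. With `H = A q /
W` the first term yields exactly the singular derivative of the energy, while the factor `A` in `H`
cancels the `1/A` in the second. -/
theorem hasDerivAt_correction {r : ℝ} {H : ℝ → ℂ} {H' : ℂ} (hA : A r ≠ 0) (hW : W r ≠ 0)
    (hXp : DifferentiableAt ℝ Xp r) (hXm : DifferentiableAt ℝ Xm r)
    (ep : A r * deriv Xp r + -Complex.I * W r / A r * Xp r = q₁ r * Xm r)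
    (em : A r * deriv Xm r + Complex.I * W r / A r * Xm r = q₂ r * Xp r)
    (hH : HasDerivAt H H' r) (hHr : H r = A r * (q₁ r + (starRingEnd ℂ) (q₂ r)) / W r) :
    HasDerivAt (fun s => (Complex.I * H s * (Xm s * (starRingEnd ℂ) (Xp s))).re)
      ((2 * (q₁ r + (starRingEnd ℂ) (q₂ r)) * (Xm r * (starRingEnd ℂ) (Xp r)) / A r).re +
        (Complex.I * H' * (Xm r * (starRingEnd ℂ) (Xp r))).re +
        (Complex.I * ((q₁ r + (starRingEnd ℂ) (q₂ r)) / W r) *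
          (q₂ r * ‖Xp r‖ ^ 2 + (starRingEnd ℂ) (q₁ r) * ‖Xm r‖ ^ 2)).re) r := by
  have hA' : (A r : ℂ) ≠ 0 := Complex.ofReal_ne_zero.2 hA
  have hW' : (W r : ℂ) ≠ 0 := Complex.ofReal_ne_zero.2 hW
  have dp : deriv Xp r = (q₁ r * Xm r + Complex.I * W r / A r * Xp r) / A r := by
    rw [eq_div_iff hA']; linear_combination ep
  have dm : deriv Xm r = (q₂ r * Xp r - Complex.I * W r / A r * Xm r) / A r := by
    rw [eq_div_iff hA']; linear_combination em
  have h1 : HasDerivAt (fun s => (starRingEnd ℂ) (Xp s)) ((starRingEnd ℂ) (deriv Xp r)) r :=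
    Complex.conjCLE.toContinuousLinearMap.hasFDerivAt.comp_hasDerivAt r hXp.hasDerivAt
  have h2 := (hH.const_mul Complex.I).mul (hXm.hasDerivAt.mul h1)
  have h3 := Complex.reCLM.hasFDerivAt.comp_hasDerivAt r h2
  refine h3.congr_deriv ?_
  simp only [Complex.reCLM_apply, ← Complex.add_re, Pi.mul_apply]
  congr 1
  rw [dp, dm, hHr, ← Complex.mul_conj', ← Complex.mul_conj']
  simp only [map_div₀, map_add, map_mul, Complex.conj_ofReal, Complex.conj_I]
  field_simp
  ring_nf
  simp only [Complex.I_sq]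
  ring

/-- A nontrivial solution of the radial system does not tend to zero at an irregular singular
point `re` with `W re ≠ 0`. -/
theorem exists_pos_le_energy (hAc : ContDiff ℝ 1 A) (hWc : ContDiff ℝ 1 W)
    (hq₁ : ContDiff ℝ 1 q₁) (hq₂ : ContDiff ℝ 1 q₂) (hAre : A re = 0)
    (hA : ∀ r, re < r → 0 < A r) (hW : W re ≠ 0)
    (hXp : ∀ r, re < r → DifferentiableAt ℝ Xp r) (hXm : ∀ r, re < r → DifferentiableAt ℝ Xm r)
    (ep : ∀ r, re < r → A r * deriv Xp r + -Complex.I * W r / A r * Xp r = q₁ r * Xm r)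
    (em : ∀ r, re < r → A r * deriv Xm r + Complex.I * W r / A r * Xm r = q₂ r * Xp r)
    {r₀ : ℝ} (hr₀ : re < r₀) (h₀ : 0 < ‖Xp r₀‖ ^ 2 + ‖Xm r₀‖ ^ 2) :
    ∃ c > 0, ∃ u > re, ∀ r ∈ Set.Ioo re u, c ≤ ‖Xp r‖ ^ 2 + ‖Xm r‖ ^ 2 := by
  set N : ℝ → ℝ := fun s => ‖Xp s‖ ^ 2 + ‖Xm s‖ ^ 2 with hN
  set q : ℝ → ℂ := fun s => q₁ s + (starRingEnd ℂ) (q₂ s) with hq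
  set Z : ℝ → ℂ := fun s => Xm s * (starRingEnd ℂ) (Xp s) with hZ
  have hZN : ∀ s, ‖Z s‖ ≤ N s / 2 := fun s => Complex.norm_mul_conj_le _ _
  have hN0 : ∀ s, 0 ≤ N s := fun s => by positivity
  have hqc : ContDiff ℝ 1 q :=
    hq₁.add (Complex.conjCLE.toContinuousLinearMap.contDiff.comp hq₂)
  set H : ℝ → ℂ := fun s => A s * q s / W s with hH
  have hofR : ContDiff ℝ 1 (fun x : ℝ => (x : ℂ)) := Complex.ofRealCLM.contDiff
  have hHc : ∀ r, W r ≠ 0 → ContDiffAt ℝ 1 H r := fun r hr => by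
    simp only [hH, div_eq_mul_inv]
    exact (((hofR.comp hAc).mul hqc).contDiffAt).mul
      ((hofR.comp hWc).contDiffAt.inv (Complex.ofReal_ne_zero.2 hr))
  have hH' : ContinuousAt (deriv H) re := by
    exact ((hHc re hW).continuousAt_fderiv one_ne_zero).clm_apply continuousAt_const
  set K₂ : ℝ → ℝ := fun s => ‖q s / W s‖ * (‖q₂ s‖ + ‖q₁ s‖) with hK₂
  have hK₂c : ContinuousAt K₂ re := by
    have : ContinuousAt (fun s => (W s : ℂ)) re := (hofR.comp hWc).continuous.continuousAt
    exact ((hqc.continuous.continuousAt.div this (Complex.ofReal_ne_zero.2 hW)).norm).mul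
      (hq₂.continuous.norm.add hq₁.continuous.norm).continuousAt
  have hHre : H re = 0 := by simp [hH, hAre]
  have e1 : ∀ᶠ r in nhds re, W r ≠ 0 := hWc.continuous.continuousAt.eventually_ne hW
  have e2 : ∀ᶠ r in nhds re, ‖H r‖ < 1 :=
    (hHc re hW).continuousAt.norm.eventually (gt_mem_nhds (by simp [hHre]))
  have e3 : ∀ᶠ r in nhds re, ‖deriv H r‖ < ‖deriv H re‖ + 1 :=
    hH'.norm.eventually (gt_mem_nhds (by simp))
  have e4 : ∀ᶠ r in nhds re, K₂ r < K₂ re + 1 := hK₂c.eventually (gt_mem_nhds (by simp))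
  obtain ⟨l, u, hlu, hsub⟩ := mem_nhds_iff_exists_Ioo_subset.1 (e1.and (e2.and (e3.and e4)))
  set K : ℝ := ‖deriv H re‖ + 1 + (K₂ re + 1) with hK
  have hKpos : 0 ≤ K := by positivity
  -- `r₁` must lie in the neighbourhood where the estimates hold, yet not beyond `r₀`, from which
  -- nontriviality is transported inward.
  obtain ⟨r₁, hr₁, hr₁u, hr₁₀⟩ : ∃ r₁, re < r₁ ∧ r₁ < u ∧ r₁ ≤ r₀ :=
    ⟨min ((re + u) / 2) r₀, lt_min (by linarith [hlu.2]) hr₀,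
      (min_le_left _ _).trans_lt (by linarith [hlu.2]), min_le_right _ _⟩
  -- On the compact interval `[r₁, r₀]` the crude rate `‖q‖ / A` is bounded, which suffices here and
  -- replaces a uniqueness theorem.
  have hN₁ : 0 < N r₁ := by
    have hcont : ContinuousOn (fun s => ‖q s‖ / A s) (Set.Icc r₁ r₀) :=
      hqc.continuous.norm.continuousOn.div hAc.continuous.continuousOn
        fun s hs => (hA s (hr₁.trans_le hs.1)).ne'
    obtain ⟨C, hC⟩ := isCompact_Icc.bddAbove_image hcont
    have := mul_exp_le_of_deriv_le_mul (C := C) hr₁₀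
      (fun r hr => hasDerivAt_energy (hA r (hr₁.trans_le hr.1)).ne' (hXp r (hr₁.trans_le hr.1))
        (hXm r (hr₁.trans_le hr.1)) (ep r (hr₁.trans_le hr.1)) (em r (hr₁.trans_le hr.1)))
      (fun r hr => by
        have hAr := hA r (hr₁.trans_le hr.1)
        have hCr : ‖q r‖ / A r ≤ C := hC ⟨r, hr, rfl⟩
        calc _ ≤ ‖2 * q r * Z r / A r‖ := Complex.re_le_norm _
          _ = 2 * (‖q r‖ / A r) * ‖Z r‖ := by
            rw [norm_div, norm_mul, norm_mul, Complex.norm_real, Real.norm_of_nonneg hAr.le]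
            simp; ring
          _ ≤ 2 * (‖q r‖ / A r) * (N r / 2) := by gcongr; exact hZN r
          _ = ‖q r‖ / A r * N r := by ring
          _ ≤ C * N r := by gcongr)
    exact lt_of_lt_of_le (by positivity) this
  -- The corrected energy. Since `H` vanishes at `re`, it is comparable to `N` nearby, and its
  -- derivative contains no `1/A`.
  set G : ℝ → ℝ := fun s => N s - (Complex.I * H s * Z s).re with hG
  have hGN : ∀ r ∈ Set.Ioo re u, N r / 2 ≤ G r ∧ G r ≤ 2 * N r := by
    intro r hr
    have h1 := (hsub ⟨hlu.1.trans hr.1, hr.2⟩).2.1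
    have h2 : |(Complex.I * H r * Z r).re| ≤ N r / 2 := by
      refine (Complex.abs_re_le_norm _).trans ?_
      rw [norm_mul, norm_mul, Complex.norm_I, one_mul]
      refine (mul_le_of_le_one_left (norm_nonneg _) h1.le).trans (hZN r)
    have h3 := abs_le.1 h2
    have := hN0 r
    constructor <;> simp only [hG] <;> linarith
  -- `G' ≤ K N ≤ 2K G` gives the exponential, taken over all of `(re, r₁)` to be uniform in `r`; the
  -- final `2` comes from `G ≤ 2N`.
  refine ⟨G r₁ * rexp (-(2 * K) * (r₁ - re)) / 2, ?_, r₁, hr₁, ?_⟩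
  · have := (hGN r₁ ⟨hr₁, hr₁u⟩).1
    have : 0 < G r₁ := by linarith
    positivity
  · intro x hx
    have key := mul_exp_le_of_deriv_le_mul (f := G) (C := 2 * K) hx.2.le
      (fun r hr => by
        have hr' : re < r := hx.1.trans_le hr.1
        have hs := hsub (⟨hlu.1.trans hr', hr.2.trans_lt hr₁u⟩ : r ∈ Set.Ioo l u)
        exact (hasDerivAt_energy (hA r hr').ne' (hXp r hr') (hXm r hr') (ep r hr') (em r hr')).sub
          (hasDerivAt_correction (hA r hr').ne' hs.1 (hXp r hr') (hXm r hr') (ep r hr') (em r hr')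
            ((hHc r hs.1).differentiableAt (by simp)).hasDerivAt rfl))
      (fun r hr => by
        have hr' : re < r := hx.1.trans_le hr.1
        have hru := hr.2.trans_lt hr₁u
        have hs := hsub (⟨hlu.1.trans hr', hru⟩ : r ∈ Set.Ioo l u)
        have b1 : -(Complex.I * deriv H r * Z r).re ≤ (‖deriv H re‖ + 1) * N r := by
          refine (neg_le_abs _).trans ((Complex.abs_re_le_norm _).trans ?_)
          rw [norm_mul, norm_mul, Complex.norm_I, one_mul]
          have := hZN r
          have := hN0 r
          refine mul_le_mul hs.2.2.1.le (by linarith) (norm_nonneg _) (by positivity)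
        have b2 : -(Complex.I * (q r / W r) *
            (q₂ r * ‖Xp r‖ ^ 2 + (starRingEnd ℂ) (q₁ r) * ‖Xm r‖ ^ 2)).re ≤ (K₂ re + 1) * N r := by
          refine (neg_le_abs _).trans ((Complex.abs_re_le_norm _).trans ?_)
          rw [norm_mul, norm_mul, Complex.norm_I, one_mul]
          have h1 : ‖q₂ r * (‖Xp r‖ : ℂ) ^ 2 + (starRingEnd ℂ) (q₁ r) * (‖Xm r‖ : ℂ) ^ 2‖ ≤
              (‖q₂ r‖ + ‖q₁ r‖) * N r := by
            refine (norm_add_le _ _).trans ?_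
            simp only [norm_mul, norm_pow, RCLike.norm_conj, Complex.norm_real, norm_norm, hN]
            nlinarith [mul_nonneg (norm_nonneg (q₂ r)) (sq_nonneg ‖Xm r‖),
              mul_nonneg (norm_nonneg (q₁ r)) (sq_nonneg ‖Xp r‖)]
          calc _ ≤ ‖q r / W r‖ * ((‖q₂ r‖ + ‖q₁ r‖) * N r) := by gcongr
            _ = K₂ r * N r := by simp only [hK₂]; ring
            _ ≤ _ := by gcongr; exact hs.2.2.2.le
        have b3 := (hGN r ⟨hr', hru⟩).1
        have b4 : K * N r ≤ K * (2 * G r) := by gcongr; linarith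
        simp only [hK, hG, hN, hZ, hq] at b1 b2 b4 ⊢
        linarith)
    have h1 := (hGN x ⟨hx.1, hx.2.trans hr₁u⟩).2
    have h2 : 0 ≤ G r₁ := (div_nonneg (hN0 _) two_pos.le).trans (hGN r₁ ⟨hr₁, hr₁u⟩).1
    have h3 : rexp (-(2 * K) * (r₁ - re)) ≤ rexp (-(2 * K) * (r₁ - x)) := by
      apply Real.exp_le_exp.2
      nlinarith [hx.1]
    have h4 := mul_le_mul_of_nonneg_left h3 h2
    simp only [hN] at h1
    linarith

end RadialSystem

/-! ### Infinite volume near the extreme horizon -/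

theorem lintegral_div_sub_eq_top {a b c : ℝ} (hab : a < b) (hc : 0 < c) :
    ∫⁻ r in Set.Ioo a b, ENNReal.ofReal (c / (r - a)) = ∞ := by
  by_contra hfin
  have hint : IntegrableOn (fun r => c / (r - a)) (Set.Ioo a b) := by
    refine ⟨Measurable.aestronglyMeasurable (by fun_prop), ?_⟩
    rw [hasFiniteIntegral_iff_ofReal]
    · exact lt_top_iff_ne_top.2 hfin
    · filter_upwards [ae_restrict_mem measurableSet_Ioo] with r hr
      exact (div_pos hc (sub_pos.2 hr.1)).le
  have h2 : IntervalIntegrable (fun r => (r - a)⁻¹) volume a b := by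
    rw [intervalIntegrable_iff_integrableOn_Ioo_of_le hab.le]
    have h3 : IntegrableOn (fun r => c⁻¹ * (c / (r - a))) (Set.Ioo a b) := hint.const_mul c⁻¹
    refine h3.congr_fun (fun r _ => ?_) measurableSet_Ioo
    simp only
    field_simp
  rw [intervalIntegrable_sub_inv_iff] at h2
  rcases h2 with h2 | h2
  · exact hab.ne h2
  · exact h2 Set.left_mem_uIcc

namespace KerrNewmanAdS

/-- The induced metric is diagonal, and the factor `1 / Δ₋(r)` comes from `g_rr`. At a double root
its square root is of order `1 / (r - re)`. -/
theorem det_slice_metric (M : KerrNewmanAdS) {x : Coord} (hr : 0 < x 1) (hΔ : 0 < M.deltaR (x 1)) :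
    Matrix.det (Matrix.of fun i j : Fin 3 => M.metric x i.succ j.succ) =
      M.U (x 1) (x 2) * sin (x 2) ^ 2 *
        (M.deltaTheta (x 2) * (x 1 ^ 2 + M.a ^ 2) ^ 2 - M.deltaR (x 1) * M.a ^ 2 * sin (x 2) ^ 2) /
        (M.deltaTheta (x 2) * M.E ^ 2) / M.deltaR (x 1) := by
  have hU := M.U_pos hr (x 2)
  have hT := M.deltaTheta_pos (x 2)
  have hE : M.E ≠ 0 := M.E_pos.ne'
  have a1 := Real.sq_sqrt hU.le
  have a2 := Real.sq_sqrt hT.le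
  have a3 := Real.sq_sqrt hΔ.le
  have b1 := (Real.sqrt_pos.2 hU).ne'
  have b2 := (Real.sqrt_pos.2 hT).ne'
  have b3 := (Real.sqrt_pos.2 hΔ).ne'
  simp only [Matrix.det_fin_three, Matrix.of_apply, metric, Fin.sum_univ_four, coframe_eq,
    show (Fin.succ 0 : Fin 4) = 1 from rfl, show (Fin.succ 1 : Fin 4) = 2 from rfl,
    show (Fin.succ 2 : Fin 4) = 3 from rfl, sign, Matrix.cons_val]
  generalize √(M.U (x 1) (x 2)) = u at *
  generalize √(M.deltaTheta (x 2)) = B at *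
  generalize √(M.deltaR (x 1)) = A at *
  rw [← a1, ← a2, ← a3]
  field_simp
  ring

theorem IsExtreme.sliceVolume_eq_top {M : KerrNewmanAdS} {re : ℝ} (h : M.IsExtreme re) (t₀ : ℝ)
    {u θ₀ : ℝ} (hu : re < u) (hθ : 0 < θ₀) (hθ' : θ₀ < π) {V : Set ℝ} (hV : V ∈ nhds θ₀) :
    M.sliceVolume re t₀
      (Set.Ioo re u ×ˢ (V ∩ Set.Ioo 0 π) ×ˢ Set.Ioo 0 (2 * π)) = ∞ := by
  -- `F` is the determinant with the factor `1 / (r - re)²` removed; it is continuous and positive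
  -- at the horizon point `(re, θ₀)`.
  obtain ⟨F, hF⟩ : ∃ F : ℝ × ℝ → ℝ, F = fun z => M.U z.1 z.2 * sin z.2 ^ 2 *
        (M.deltaTheta z.2 * (z.1 ^ 2 + M.a ^ 2) ^ 2 - M.deltaR z.1 * M.a ^ 2 * sin z.2 ^ 2) /
        (M.deltaTheta z.2 * M.E ^ 2) / M.cofactor re z.1 := ⟨_, rfl⟩
  have hE : M.E ≠ 0 := M.E_pos.ne'
  have hFc : ContinuousAt F (re, θ₀) := by
    rw [hF]
    have c1 : Continuous fun z : ℝ × ℝ => M.deltaTheta z.2 * M.E ^ 2 := by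
      unfold deltaTheta; fun_prop
    have c2 : Continuous fun z : ℝ × ℝ => M.cofactor re z.1 := by
      unfold cofactor; fun_prop
    refine ContinuousAt.div (ContinuousAt.div ?_ c1.continuousAt ?_) c2.continuousAt ?_
    · refine Continuous.continuousAt ?_
      unfold U deltaTheta deltaR
      fun_prop
    · exact mul_ne_zero (M.deltaTheta_pos _).ne' (pow_ne_zero 2 hE)
    · exact (M.cofactor_pos _ _).ne'
  have hF0 : 0 < F (re, θ₀) := by
    have h1 := M.U_pos h.1 θ₀
    have h2 := M.deltaTheta_pos θ₀
    have h3 := Real.sin_pos_of_pos_of_lt_pi hθ hθ'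
    have h4 := M.cofactor_pos re re
    have h5 : M.deltaR re = 0 := by rw [h.deltaR_eq]; simp
    have h6 : 0 < re ^ 2 + M.a ^ 2 := by have := h.1; positivity
    simp only [hF, h5, zero_mul, sub_zero]
    have : 0 < M.E := M.E_pos
    positivity
  have hev := hFc.eventually (lt_mem_nhds (half_lt_self hF0))
  rw [nhds_prod_eq] at hev
  obtain ⟨p₁, hp₁, p₂, hp₂, hp⟩ := Filter.eventually_prod_iff.1 hev
  obtain ⟨l, w, hlw, hsub⟩ := mem_nhds_iff_exists_Ioo_subset.1 hp₁
  -- `V` need not be measurable, so the estimate is made on an open box inside the set.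
  obtain ⟨α, β, hαβ, hsub'⟩ := mem_nhds_iff_exists_Ioo_subset.1
    (Filter.inter_mem (Filter.inter_mem hp₂ hV) (Ioo_mem_nhds hθ hθ'))
  set c := √(F (re, θ₀) / 2) with hc
  have hcpos : 0 < c := Real.sqrt_pos.2 (half_pos hF0)
  set S : Set (ℝ × ℝ × ℝ) := Set.Ioo re (min u w) ×ˢ Set.Ioo α β ×ˢ Set.Ioo 0 (2 * π) with hS
  have hSm : MeasurableSet S :=
    measurableSet_Ioo.prod (measurableSet_Ioo.prod measurableSet_Ioo)
  have hSsub : S ⊆ Set.Ioo re u ×ˢ (V ∩ Set.Ioo 0 π) ×ˢ Set.Ioo 0 (2 * π) := by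
    refine Set.prod_mono (Set.Ioo_subset_Ioo_right (min_le_left _ _))
      (Set.prod_mono (fun θ hθ => ?_) subset_rfl)
    exact ⟨(hsub' hθ).1.2, (hsub' hθ).2⟩
  refine measure_mono_top hSsub ?_
  rw [sliceVolume, withDensity_apply _ hSm, Measure.restrict_restrict hSm]
  have hSR : S ∩ (Set.Ioi re ×ˢ Set.Ioo 0 π ×ˢ Set.Ioo 0 (2 * π)) = S := by
    refine Set.inter_eq_left.2 (hSsub.trans ?_)
    exact Set.prod_mono Set.Ioo_subset_Ioi_self (Set.prod_mono Set.inter_subset_right subset_rfl)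
  rw [hSR, eq_top_iff]
  have hlow : ∫⁻ q in S, ENNReal.ofReal (c / (q.1 - re)) = ∞ := by
    rw [hS, Measure.volume_eq_prod, ← Measure.prod_restrict, lintegral_prod _ (by fun_prop)]
    simp only [lintegral_const]
    rw [lintegral_mul_const _ (by fun_prop),
      lintegral_div_sub_eq_top (lt_min hu hlw.2) hcpos, ENNReal.top_mul]
    rw [Measure.restrict_apply_univ, Measure.volume_eq_prod, Measure.prod_prod]
    simp [hαβ.1.trans hαβ.2, Real.pi_pos]
  rw [← hlow]
  refine setLIntegral_mono' hSm fun q hq => ENNReal.ofReal_le_ofReal ?_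
  obtain ⟨⟨hq1, hq2⟩, hq3, hq4⟩ := hq
  have hr : 0 < q.1 - re := sub_pos.2 hq1
  have hFq : F (re, θ₀) / 2 < F (q.1, q.2.1) :=
    hp (hsub ⟨hlw.1.trans hq1, hq2.trans_le (min_le_right _ _)⟩) (hsub' hq3).1.1
  have hdet := M.det_slice_metric (x := ![t₀, q.1, q.2.1, q.2.2]) (h.1.trans hq1)
    (h.deltaR_pos hq1)
  rw [hdet]
  simp only [Matrix.cons_val]
  have : M.U q.1 q.2.1 * sin q.2.1 ^ 2 *
        (M.deltaTheta q.2.1 * (q.1 ^ 2 + M.a ^ 2) ^ 2 - M.deltaR q.1 * M.a ^ 2 * sin q.2.1 ^ 2) /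
        (M.deltaTheta q.2.1 * M.E ^ 2) / M.deltaR q.1 = F (q.1, q.2.1) / (q.1 - re) ^ 2 := by
    rw [hF]
    simp only
    rw [div_div _ (M.cofactor re q.1), mul_comm (M.cofactor re q.1), ← h.deltaR_eq]
  rw [this, Real.sqrt_div' _ (sq_nonneg _), Real.sqrt_sq hr.le]
  gcongr
  exact Real.sqrt_le_sqrt hFq.le

end KerrNewmanAdS

/-! ### Lower bounds for separated solutions and failure of integrability -/

namespace KerrNewmanAdS

section Separated

variable {M : KerrNewmanAdS} {re lam ω : ℝ} {k : ℤ} {Xp Xm Yp Ym : ℝ → ℂ} {Ψ : SpinorField}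

theorem spinScale_mul_separated (hre : 0 < re) (hΔ : ∀ r, re < r → 0 < M.deltaR r)
    (hform : ∀ x ∈ exterior re, Ψ x = (M.scaling x)⁻¹ *ᵥ separated ω k Xp Xm Yp Ym x)
    {y : Coord} (hy : y ∈ exterior re) (i : Fin 4) :
    M.spinScale (![M.a, M.a, -M.a, -M.a] i) (y 1) (y 2) * Ψ y i =
      Complex.exp (-Complex.I * (ω * y 0 + ((k : ℂ) + 1 / 2) * y 3)) *
        (![Xm, Xp, Xp, Xm] i (y 1) * ![Ym, Yp, Ym, Yp] i (y 2)) := by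
  rw [M.spinScale_mul_apply (hre.trans hy.1) (hΔ _ hy.1) (hform y hy) i]
  fin_cases i <;> simp [separated]

/-- The regularity of `Ψ` controls only products of radial and angular factors; a single factor
inherits it where the other is nonzero. -/
theorem differentiableAt_radial_mul (hre : 0 < re) (hΔ : ∀ r, re < r → 0 < M.deltaR r)
    (hform : ∀ x ∈ exterior re, Ψ x = (M.scaling x)⁻¹ *ᵥ separated ω k Xp Xm Yp Ym x)
    (hsol : M.IsDiracSolution re lam Ψ) {r θ : ℝ} (hr : re < r) (hθ : 0 < θ) (hθ' : θ < π)
    (i : Fin 4) :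
    DifferentiableAt ℝ (fun s => ![Xm, Xp, Xp, Xm] i s * ![Ym, Yp, Ym, Yp] i θ) r := by
  have hx : (![0, r, θ, 0] : Coord) ∈ exterior re := ⟨hr, hθ, hθ'⟩
  have hd := hsol.1.differentiableAt ((isOpen_exterior re).mem_nhds hx)
  have d1 := hasDerivAt_update_of_differentiableAt (differentiableAt_pi.1 hd i) 1
  change HasDerivAt _ _ r at d1
  refine ((M.hasDerivAt_spinScale_left (![M.a, M.a, -M.a, -M.a] i) θ (hre.trans hr)
    (hΔ r hr)).mul d1).differentiableAt.congr_of_eventuallyEq ?_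
  filter_upwards [lt_mem_nhds hr] with s hs
  have hu : Function.update (![0, r, θ, 0] : Coord) 1 s = ![0, s, θ, 0] := by
    ext j; fin_cases j <;> simp
  have := spinScale_mul_separated hre hΔ hform
    (show (![0, s, θ, 0] : Coord) ∈ exterior re from ⟨hs, hθ, hθ'⟩) i
  simpa [hu] using this.symm

theorem differentiableAt_angular_mul (hre : 0 < re) (hΔ : ∀ r, re < r → 0 < M.deltaR r)
    (hform : ∀ x ∈ exterior re, Ψ x = (M.scaling x)⁻¹ *ᵥ separated ω k Xp Xm Yp Ym x)
    (hsol : M.IsDiracSolution re lam Ψ) {r θ : ℝ} (hr : re < r) (hθ : 0 < θ) (hθ' : θ < π)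
    (i : Fin 4) :
    DifferentiableAt ℝ (fun s => ![Xm, Xp, Xp, Xm] i r * ![Ym, Yp, Ym, Yp] i s) θ := by
  have hx : (![0, r, θ, 0] : Coord) ∈ exterior re := ⟨hr, hθ, hθ'⟩
  have hd := hsol.1.differentiableAt ((isOpen_exterior re).mem_nhds hx)
  have d1 := hasDerivAt_update_of_differentiableAt (differentiableAt_pi.1 hd i) 2
  change HasDerivAt _ _ θ at d1
  refine ((M.hasDerivAt_spinScale_right (![M.a, M.a, -M.a, -M.a] i) θ
    (hre.trans hr)).mul d1).differentiableAt.congr_of_eventuallyEq ?_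
  filter_upwards [lt_mem_nhds hθ, gt_mem_nhds hθ'] with s hs hs'
  have hu : Function.update (![0, r, θ, 0] : Coord) 2 s = ![0, r, s, 0] := by
    ext j; fin_cases j <;> simp
  have := spinScale_mul_separated hre hΔ hform
    (show (![0, r, s, 0] : Coord) ∈ exterior re from ⟨hr, hs, hs'⟩) i
  simpa [hu] using this.symm

theorem norm_component (hre : 0 < re) (hΔ : ∀ r, re < r → 0 < M.deltaR r)
    (hform : ∀ x ∈ exterior re, Ψ x = (M.scaling x)⁻¹ *ᵥ separated ω k Xp Xm Yp Ym x)
    {y : Coord} (hy : y ∈ exterior re) (i : Fin 4) :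
    √(M.deltaR (y 1)) * √(M.U (y 1) (y 2)) * ‖Ψ y i‖ ^ 2 =
      ‖![Xm, Xp, Xp, Xm] i (y 1)‖ ^ 2 * ‖![Ym, Yp, Ym, Yp] i (y 2)‖ ^ 2 := by
  have h := congrArg (‖·‖ ^ 2) (spinScale_mul_separated hre hΔ hform hy i)
  have hb : (![M.a, M.a, -M.a, -M.a] i) ^ 2 = M.a ^ 2 := by fin_cases i <;> simp
  have hexp : ‖Complex.exp (-Complex.I * (ω * y 0 + ((k : ℂ) + 1 / 2) * y 3))‖ = 1 := by
    rw [show -Complex.I * (ω * y 0 + ((k : ℂ) + 1 / 2) * y 3) =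
      ((-(ω * y 0 + ((k : ℝ) + 1 / 2) * y 3) : ℝ) : ℂ) * Complex.I by push_cast; ring]
    exact Complex.norm_exp_ofReal_mul_I _
  simp only [norm_mul, hexp, one_mul, M.norm_spinScale _ _ (hΔ _ hy.1), mul_pow, hb,
    Real.sq_sqrt (Real.sqrt_nonneg _)] at h
  exact h

/-- If an angular factor is nonzero at `θ`, the radial factors solve a first-order system with
off-diagonal coefficients that are affine in `r`, hence do not tend to zero at the horizon. -/
theorem exists_pos_le_radial (hext : M.IsExtreme re)
    (hform : ∀ x ∈ exterior re, Ψ x = (M.scaling x)⁻¹ *ᵥ separated ω k Xp Xm Yp Ym x)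
    (hsol : M.IsDiracSolution re lam Ψ) (hW : M.radialPotential ω k re ≠ 0)
    {r₀ θ : ℝ} (hr₀ : re < r₀) (hθ : 0 < θ) (hθ' : θ < π)
    (h₀ : 0 < ‖Xp r₀‖ ^ 2 + ‖Xm r₀‖ ^ 2) (hY : Ym θ ≠ 0 ∨ Yp θ ≠ 0) :
    ∃ c > 0, ∃ u > re, ∀ r ∈ Set.Ioo re u, c ≤ ‖Xp r‖ ^ 2 + ‖Xm r‖ ^ 2 := by
  have hΔ := fun r => hext.deltaR_pos (r := r)
  set A : ℝ → ℝ := fun r => (r - re) * √(M.cofactor re r) with hA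
  have hAeq : ∀ r, re < r → √(M.deltaR r) = A r := fun r hr => hext.sqrt_deltaR hr
  have hcof : ContDiff ℝ 1 (M.cofactor re) := by unfold cofactor; fun_prop
  have hAc : ContDiff ℝ 1 A :=
    (by fun_prop : ContDiff ℝ 1 fun r => r - re).mul
      (hcof.sqrt fun r => (M.cofactor_pos re r).ne')
  have hWc : ContDiff ℝ 1 (M.radialPotential ω k) := by unfold radialPotential; fun_prop
  have hqc : ∀ z l w : ℂ, ContDiff ℝ 1 fun r : ℝ => z + l * (r + w) := fun z l w =>
    contDiff_const.add (contDiff_const.mul (Complex.ofRealCLM.contDiff.add contDiff_const))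
  have hApos : ∀ r, re < r → 0 < A r := fun r hr =>
    mul_pos (sub_pos.2 hr) (Real.sqrt_pos.2 (M.cofactor_pos _ _))
  have hsys := fun r hr =>
    M.separated_system hext.1 hΔ hform hsol (r := r) (θ := θ) hr hθ hθ'
  have hdiff := fun (r : ℝ) (hr : re < r) (i : Fin 4) =>
    differentiableAt_radial_mul hext.1 hΔ hform hsol hr hθ hθ' i
  have hdiv : ∀ {X : ℝ → ℂ} {z : ℂ} {r : ℝ}, z ≠ 0 → DifferentiableAt ℝ (fun s => X s * z) r →
      DifferentiableAt ℝ X r := fun {X z r} hz h => by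
    have := h.mul_const z⁻¹
    simpa [hz] using this
  rcases hY with hY | hY
  -- With `Y₋(θ) ≠ 0`, the first and third equations are divided by it. The angular operator becomes
  -- a constant, and `r` enters `q₁`, `q₂` only through the mass term.
  · refine exists_pos_le_energy (A := A) (W := M.radialPotential ω k)
      (q₁ := fun r => M.angular ω k 1 θ (Yp θ) (deriv Yp θ) / Ym θ +
        Complex.I * lam * (r + Complex.I * (-M.a : ℝ) * cos θ))
      (q₂ := fun r => M.angular ω k 1 θ (Yp θ) (deriv Yp θ) / Ym θ +
        -(Complex.I * lam) * (r + Complex.I * M.a * cos θ))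
      hAc hWc (hqc _ _ _) (hqc _ _ _) (by simp [hA]) hApos hW
      (fun r hr => hdiv hY (hdiff r hr 2)) (fun r hr => hdiv hY (hdiff r hr 0)) ?_ ?_ hr₀ h₀
    · intro r hr
      have := (hsys r hr).1
      rw [hAeq r hr] at this
      have hA0 : (A r : ℂ) ≠ 0 := Complex.ofReal_ne_zero.2 (hApos r hr).ne'
      field_simp at this ⊢
      linear_combination -this
    · intro r hr
      have := (hsys r hr).2.2.1
      rw [hAeq r hr] at this
      have hA0 : (A r : ℂ) ≠ 0 := Complex.ofReal_ne_zero.2 (hApos r hr).ne'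
      field_simp at this ⊢
      linear_combination this
  · refine exists_pos_le_energy (A := A) (W := M.radialPotential ω k)
      (q₁ := fun r => -M.angular ω k (-1) θ (Ym θ) (deriv Ym θ) / Yp θ +
        Complex.I * lam * (r + Complex.I * M.a * cos θ))
      (q₂ := fun r => -M.angular ω k (-1) θ (Ym θ) (deriv Ym θ) / Yp θ +
        -(Complex.I * lam) * (r + Complex.I * (-M.a : ℝ) * cos θ))
      hAc hWc (hqc _ _ _) (hqc _ _ _) (by simp [hA]) hApos hW
      (fun r hr => hdiv hY (hdiff r hr 1)) (fun r hr => hdiv hY (hdiff r hr 3)) ?_ ?_ hr₀ h₀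
    · intro r hr
      have := (hsys r hr).2.2.2
      rw [hAeq r hr] at this
      have hA0 : (A r : ℂ) ≠ 0 := Complex.ofReal_ne_zero.2 (hApos r hr).ne'
      field_simp at this ⊢
      linear_combination -this
    · intro r hr
      have := (hsys r hr).2.1
      rw [hAeq r hr] at this
      have hA0 : (A r : ℂ) ≠ 0 := Complex.ofReal_ne_zero.2 (hApos r hr).ne'
      field_simp at this ⊢
      linear_combination this

/-- An angular factor `Y` that is bounded away from zero near some `θ₀` rules out integrability
at the horizon. -/
theorem not_memLpSlice (hext : M.IsExtreme re) {t₀ p : ℝ} (hp : 1 ≤ p) {N : ℝ → ℝ} {Y : ℝ → ℂ}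
    {θ₀ : ℝ} (hθ : 0 < θ₀) (hθ' : θ₀ < π) (hY : Y θ₀ ≠ 0) (hYc : ContinuousAt Y θ₀)
    (hN : ∃ c > 0, ∃ u > re, ∀ r ∈ Set.Ioo re u, c ≤ N r)
    (hlow : ∀ y ∈ exterior re, N (y 1) * ‖Y (y 2)‖ ^ 2 ≤
      √(M.deltaR (y 1)) * √(M.U (y 1) (y 2)) * ∑ i, ‖Ψ y i‖ ^ 2) :
    ¬ M.MemLpSlice re t₀ p Ψ := by
  intro hLp
  obtain ⟨c, hc, u, hu, hcN⟩ := hN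
  have hYpos : 0 < ‖Y θ₀‖ := norm_pos_iff.2 hY
  have hcont : Continuous fun z : ℝ × ℝ => √(M.deltaR z.1) * √(M.U z.1 z.2) := by
    unfold deltaR U; fun_prop
  have hzero : √(M.deltaR re) * √(M.U re θ₀) = 0 := by simp [hext.deltaR_eq]
  have hev : ∀ᶠ z in nhds (re, θ₀), √(M.deltaR z.1) * √(M.U z.1 z.2) < 1 :=
    hcont.continuousAt.eventually (gt_mem_nhds (by simp [hzero]))
  rw [nhds_prod_eq] at hev
  obtain ⟨p₁, hp₁, p₂, hp₂, hpp⟩ := Filter.eventually_prod_iff.1 hev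
  obtain ⟨l, w, hlw, hsub⟩ := mem_nhds_iff_exists_Ioo_subset.1 hp₁
  have hV : {θ | p₂ θ ∧ ‖Y θ₀‖ / 2 < ‖Y θ‖} ∈ nhds θ₀ :=
    hp₂.and (hYc.norm.eventually (lt_mem_nhds (half_lt_self hYpos)))
  have htop := hext.sliceVolume_eq_top t₀ (lt_min hu hlw.2) hθ hθ' hV
  set ε : ℝ := √(c * (‖Y θ₀‖ / 2) ^ 2) with hε
  have hεpos : 0 < ε := Real.sqrt_pos.2 (by positivity)
  -- Chebyshev's inequality: for finite nonzero exponent the set where `|Ψ| ≥ ε` has finite measure,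
  -- yet it contains the box of infinite volume.
  have hfin := hLp.meas_ge_lt_top (ε := ⟨ε, hεpos.le⟩)
    (by simpa using lt_of_lt_of_le one_pos hp) ENNReal.ofReal_ne_top
    (by intro h0; exact hεpos.ne' (congrArg Subtype.val h0))
  refine hfin.ne (measure_mono_top ?_ htop)
  rintro ⟨r, θ, φ⟩ ⟨⟨hr, hru⟩, ⟨⟨hpθ, hYθ⟩, hθ0, hθπ⟩, -⟩
  have hy : (![t₀, r, θ, φ] : Coord) ∈ exterior re := ⟨hr, hθ0, hθπ⟩
  have h1 := hlow _ hy
  simp only [Matrix.cons_val] at h1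
  have h2 := hcN r ⟨hr, hru.trans_le (min_le_left _ _)⟩
  have h3 : √(M.deltaR r) * √(M.U r θ) < 1 :=
    hpp (hsub ⟨hlw.1.trans hr, hru.trans_le (min_le_right _ _)⟩) hpθ
  have h4 : c * (‖Y θ₀‖ / 2) ^ 2 ≤ ∑ i, ‖Ψ ![t₀, r, θ, φ] i‖ ^ 2 := by
    calc _ ≤ N r * ‖Y θ‖ ^ 2 := by
            gcongr
            exact hc.le.trans h2
      _ ≤ _ := h1
      _ ≤ _ := mul_le_of_le_one_left (Finset.sum_nonneg fun i _ => sq_nonneg _) h3.le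
  refine NNReal.coe_le_coe.1
    (show ε ≤ ‖(WithLp.toLp 2 (Ψ ![t₀, r, θ, φ]) : EuclideanSpace ℂ (Fin 4))‖ from ?_)
  rw [EuclideanSpace.norm_eq]
  exact Real.sqrt_le_sqrt h4

end Separated

end KerrNewmanAdS

theorem theorem5p1 (M : KerrNewmanAdS) (re : ℝ) (hre : M.IsExtreme re)
    (lam ω : ℝ) (k : ℤ) (Xp Xm Yp Ym : ℝ → ℂ) (Ψ : KerrNewmanAdS.SpinorField)
    (hform : ∀ x ∈ KerrNewmanAdS.exterior re,
      Ψ x = (M.scaling x)⁻¹ *ᵥ KerrNewmanAdS.separated ω k Xp Xm Yp Ym x)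
    (hsol : M.IsDiracSolution re lam Ψ)
    (hnontrivial : ∃ x ∈ KerrNewmanAdS.exterior re, Ψ x ≠ 0)
    (t₀ p : ℝ) (hp : 1 ≤ p) (hLp : M.MemLpSlice re t₀ p Ψ) :
    ω * (re ^ 2 + M.a ^ 2) + ((k : ℝ) + 1 / 2) * M.E * M.a + re * M.Q = 0 := by
  by_contra hW
  obtain ⟨x, hx, hΨ⟩ := hnontrivial
  have hΔ := fun r => hre.deltaR_pos (r := r)
  obtain ⟨i, hi⟩ : ∃ i, Ψ x i ≠ 0 := Function.ne_iff.1 hΨ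
  have hmul := KerrNewmanAdS.spinScale_mul_separated hre.1 hΔ hform hx i
  have hne := mul_ne_zero
    (M.spinScale_ne_zero (![M.a, M.a, -M.a, -M.a] i) (x 2) (hre.1.trans hx.1) (hΔ _ hx.1)) hi
  rw [hmul] at hne
  have hXY := right_ne_zero_of_mul hne
  have hX := left_ne_zero_of_mul hXY
  have hY := right_ne_zero_of_mul hXY
  -- The component nonzero at `x` supplies both inputs: its radial factor makes `N` positive at one
  -- radius, and its angular factor is nonzero and continuous at one angle.
  have hYc : ContinuousAt (![Ym, Yp, Ym, Yp] i) (x 2) := by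
    have h := (KerrNewmanAdS.differentiableAt_angular_mul hre.1 hΔ hform hsol hx.1 hx.2.1
      hx.2.2 i).continuousAt.const_mul (![Xm, Xp, Xp, Xm] i (x 1))⁻¹
    simpa only [inv_mul_cancel_left₀ hX] using h
  have h₀ : 0 < ‖Xp (x 1)‖ ^ 2 + ‖Xm (x 1)‖ ^ 2 := by
    have : 0 < ‖![Xm, Xp, Xp, Xm] i (x 1)‖ := norm_pos_iff.2 hX
    fin_cases i <;> simp at this <;> positivity
  have hY' : Ym (x 2) ≠ 0 ∨ Yp (x 2) ≠ 0 := by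
    fin_cases i <;> simp at hY <;> tauto
  have hN := KerrNewmanAdS.exists_pos_le_radial hre hform hsol hW hx.1 hx.2.1 hx.2.2 h₀ hY'
  refine KerrNewmanAdS.not_memLpSlice hre hp hx.2.1 hx.2.2 hY hYc hN (fun y hy => ?_) hLp
  have hc := KerrNewmanAdS.norm_component hre.1 hΔ hform hy
  have c0 := hc 0
  have c1 := hc 1
  have c2 := hc 2
  have c3 := hc 3
  simp only [Matrix.cons_val] at c0 c1 c2 c3
  rw [Fin.sum_univ_four, mul_add, mul_add, mul_add, c0, c1, c2, c3]
  have e0 := mul_nonneg (sq_nonneg ‖Xm (y 1)‖) (sq_nonneg ‖Ym (y 2)‖)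
  have e1 := mul_nonneg (sq_nonneg ‖Xp (y 1)‖) (sq_nonneg ‖Yp (y 2)‖)
  have e2 := mul_nonneg (sq_nonneg ‖Xp (y 1)‖) (sq_nonneg ‖Ym (y 2)‖)
  have e3 := mul_nonneg (sq_nonneg ‖Xm (y 1)‖) (sq_nonneg ‖Yp (y 2)‖)
  -- Each angular factor occurs once with `X₊` and once with `X₋`, so two of the four summands
  -- already give the left side; the other two are nonnegative.
  fin_cases i <;> simp <;> linarith
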